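/- Let $\sigma$ be the normalized surface measure on the unit sphere $\mathbb S^2\subset\mathbb R^3$, and for $x\in\mathbb S^2$ (different from the north pole) let $g(x)\in\mathbb C$ be its stereographic projection from the north pole, $g(x)=\frac{x_1+i x_2}{1-x_3}$. For $N\ge 1$, the spherical ensemble is the process of $N$ random points $x_1,\dots,x_N\in\mathbb S^2$ whose joint intensities with respect to $\sigma$ are $\varrho_\ell(y_1,\dots,y_\ell)=\det\big(K_N(y_i,y_j)\big)_{i,j=1}^{\ell}$, $\ell\ge 1$, where $$K_N(x,y)=N\,\frac{(1+z\bar w)^{N-1}}{(1+|z|^2)^{\frac{N-1}{2}}(1+|w|^2)^{\frac{N-1}{2}}},\qquad z=g(x),\ w=g(y).$$ Let $f\in H^1(\mathbb S^2)$ be real- or complex-valued, that is, $f\in L^1(\mathbb S^2)$ has a weak gradient $\nabla f$ on the sphere, and $\nabla f\in L^2$. If, for each $N$, the points $x_1,\dots,x_N$ are drawn from the spherical ensemble, then $\sum_{j=1}^N f(x_j)$ is square integrable for each $N$ and $$\lim_{N\to\infty}\operatorname{Var}\Big(\sum_{j=1}^N f(x_j)\Big)=\int_{\mathbb S^2}|\nabla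 f(x)|^2\,d\sigma(x),$$ where $\operatorname{Var}(X)=\mathbb E|X-\mathbb E X|^2$. -/

import Mathlib

/-! Spherical ensemble on the unit sphere of three-space, weak gradients on the sphere. -/

noncomputable section

namespace SphericalEnsemble

open MeasureTheory

open scoped ENNReal ComplexConjugate

/-- Euclidean three-space. -/
abbrev E3 : Type := EuclideanSpace ℝ (Fin 3)

/-- The unit sphere in Euclidean three-space. -/
abbrev S2 : Type := Metric.sphere (0 : E3) 1

/-- The normalized surface measure on the sphere (total mass one). -/
def σ : Measure S2 :=
  ((volume : Measure E3).toSphere Set.univ)⁻¹ • (volume : Measure E3).toSphere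

/-- Stereographic projection from the north pole `(0, 0, 1)` to the complex plane. At the north
pole itself (a null set for `σ`) the value is the junk value `0`. -/
def stereo (x : S2) : ℂ :=
  ((x : E3) 0 + (x : E3) 1 * Complex.I) / (1 - (x : E3) 2)

/-- The kernel of the spherical ensemble with `N` points, relative to `σ`:
`N (1 + z w̄)^(N-1) / ((1 + |z|²)^((N-1)/2) (1 + |w|²)^((N-1)/2))`, where `z`, `w` are the
stereographic projections of the two points. It vanishes for `N = 0`. -/
def kernel (N : ℕ) (x y : S2) : ℂ :=
  N * (1 + stereo x * conj (stereo y)) ^ (N - 1) /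
    ((Real.sqrt (1 + ‖stereo x‖ ^ 2) ^ (N - 1) * Real.sqrt (1 + ‖stereo y‖ ^ 2) ^ (N - 1) : ℝ) : ℂ)

/-- `x 1, …, x N` are `N` random points on the sphere, drawn from the spherical ensemble: for
every `l`, the `l`-th joint intensity of the point process with respect to `σ` is
`det (K_N (y i, y j))_{i, j ≤ l}`. That is, for each nonnegative measurable `φ`, the expectation of
the sum of `φ` over all `l`-tuples of points with pairwise distinct labels is the integral
of `φ` times the determinant. (The determinant is real and nonnegative, the matrix being Hermitian
and positive semidefinite.) -/
structure IsSphericalEnsemble {Ω : Type*} [MeasurableSpace Ω] (P : Measure Ω) (N : ℕ)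
    (x : Fin N → Ω → S2) : Prop where
  measurable : ∀ i, Measurable (x i)
  jointIntensity : ∀ (l : ℕ) (φ : (Fin l → S2) → ℝ≥0∞), Measurable φ →
    ∫⁻ ω, ∑ e : Fin l ↪ Fin N, φ (fun k => x (e k) ω) ∂P =
      ∫⁻ y, φ y * ENNReal.ofReal (Matrix.det (Matrix.of fun i j => kernel N (y i) (y j))).re
        ∂(Measure.pi fun _ : Fin l => σ)

/-- The variance `E |X - E X|²` of a real or complex random variable `X`. -/
def scalarVariance {𝕜 : Type*} [RCLike 𝕜] {Ω : Type*} [MeasurableSpace Ω] (P : Measure Ω)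
    (X : Ω → 𝕜) : ℝ :=
  ∫ ω, ‖X ω - ∫ ω', X ω' ∂P‖ ^ 2 ∂P

/-- The divergence on the sphere of a smooth vector field that is tangent to the sphere and is
given through a smooth extension to three-space: the trace of the derivative over the tangent plane,
that is, the full trace minus the contribution of the normal direction. It does not depend on the
extension. -/
def sphereDiv (X : E3 → E3) (x : S2) : ℝ :=
  (∑ i, fderiv ℝ X x (EuclideanSpace.single i 1) i) - inner ℝ (fderiv ℝ X x x) (x : E3)

/-- `G` is the weak (distributional) gradient on the sphere of the integrable function `f`: it is an
integrable tangent vector field and `∫ f div X dσ = - ∫ ⟨G, X⟩ dσ` for all smooth tangent vector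
fields `X` on the sphere. For complex `f` the field `G` has complex coordinates. -/
structure IsWeakGradient {𝕜 : Type*} [RCLike 𝕜] (f : S2 → 𝕜) (G : S2 → EuclideanSpace 𝕜 (Fin 3)) :
    Prop where
  integrable_fun : Integrable f σ
  integrable_grad : Integrable G σ
  tangent : ∀ᵐ x : S2 ∂σ, ∑ i, x.1 i • G x i = 0
  integral_div : ∀ X : E3 → E3, ContDiff ℝ (⊤ : ℕ∞) X → (∀ x : S2, inner ℝ (X x) (x : E3) = 0) →
    ∫ x, sphereDiv X x • f x ∂σ = - ∫ x, ∑ i, X x i • G x i ∂σ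

end SphericalEnsemble

end

/-! With N = m + 1, stereographic coordinates give |K_N(x,y)|² = N k_m(⟨x,y⟩), where k_m(t) =
N((1+t)/2)^m is `zonal`. Put Q_m(f) = ∬ k_m ⟨f(x), f(y)⟩ (`zonalForm`). The first two intensities
then give Var = (m+1)(‖f‖² − Q_m(f)), norms in L²(σ) (`IsSphericalEnsemble.variance_sum`).

The limit comes from a recursion in m. The infinitesimal rotations L_i satisfy ∑ L_i² = Δ on the
sphere, and Δk_{m+1} = (m+1)(m+2)(k_m − k_{m+1}). Integrating by parts twice yields Q_{m+1}(f) −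
Q_m(f) = ∑ Q_{m+1}(L_i f) / ((m+1)(m+2)) (`HasRotDeriv.zonalForm_succ_sub`). The k_m are probability
kernels concentrating on the diagonal, so Q_m(h) → ‖h‖² for h in L² (`tendsto_zonalForm`). Summing
the recursion from m to infinity, with ∑_{j≥m} 1/((j+1)(j+2)) = 1/(m+1), gives (m+1)(‖f‖² − Q_m(f))
→ ∑ ‖L_i f‖² = ‖∇f‖² (`HasRotDeriv.tendsto_defect`). No spherical harmonics are needed.

That f is in L² has to be proved. The recursion bounds Q_m(f) uniformly; positive definiteness of
k_m bounds the L² norms of the averages of f against k_m by Q_m(f)^{1/2}; these averages tend to f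
in L¹, and Fatou concludes (`HasRotDeriv.memLp_two`). Values in a real Hilbert space cover real and
complex f at once. -/

noncomputable section

namespace SphericalEnsemble

open MeasureTheory Filter Topology Set

open scoped ENNReal ComplexConjugate RealInnerProductSpace Pointwise

/-! ### Rotations and the invariant measure on the sphere -/

/-- The vector product with the `i`-th vector of the standard basis, the infinitesimal rotation
about the `i`-th axis. -/
def rotField (i : Fin 3) : E3 →L[ℝ] E3 :=
  (EuclideanSpace.proj (i + 1) : E3 →L[ℝ] ℝ).smulRight (EuclideanSpace.single (i + 2) 1) -
    (EuclideanSpace.proj (i + 2) : E3 →L[ℝ] ℝ).smulRight (EuclideanSpace.single (i + 1) 1)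

lemma rotField_apply (i j : Fin 3) (y : E3) :
    rotField i y j = (if j = i + 2 then y (i + 1) else 0) - (if j = i + 1 then y (i + 2) else 0) := by
  simp [rotField]

lemma inner_eq_three (x y : E3) : ⟪x, y⟫ = x 0 * y 0 + x 1 * y 1 + x 2 * y 2 := by
  simp [PiLp.inner_apply, Fin.sum_univ_three, mul_comm]

lemma norm_sq_three (x : E3) : ‖x‖ ^ 2 = x 0 ^ 2 + x 1 ^ 2 + x 2 ^ 2 := by
  simp [EuclideanSpace.norm_sq_eq, Fin.sum_univ_three]

lemma inner_rotField_self (i : Fin 3) (y : E3) : ⟪rotField i y, y⟫ = 0 := by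
  rw [inner_eq_three]
  fin_cases i <;> simp [rotField_apply] <;> ring

lemma inner_rotField_left (i : Fin 3) (x y : E3) : ⟪x, rotField i y⟫ = - ⟪y, rotField i x⟫ := by
  rw [inner_eq_three, inner_eq_three]
  fin_cases i <;> simp [rotField_apply] <;> ring

lemma S2.norm_sq (x : S2) : (x : E3) 0 ^ 2 + (x : E3) 1 ^ 2 + (x : E3) 2 ^ 2 = 1 := by
  rw [← norm_sq_three]; simp

lemma trace_rotField (i : Fin 3) :
    ∑ j, rotField i (EuclideanSpace.single j 1) j = 0 := by
  fin_cases i <;> simp [rotField_apply]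

/-- The rotation about the `i`-th axis by the angle `θ`. -/
def rotLin (i : Fin 3) (θ : ℝ) : E3 →ₗᵢ[ℝ] E3 where
  toLinearMap :=
    -- Rodrigues' formula: the last summand is the projection onto the plane of rotation, which is
    -- minus the square of `rotField i`.
    (ContinuousLinearMap.id ℝ E3 + Real.sin θ • rotField i +
      (Real.cos θ - 1) •
        ((EuclideanSpace.proj (i + 1) : E3 →L[ℝ] ℝ).smulRight (EuclideanSpace.single (i + 1) 1) +
        (EuclideanSpace.proj (i + 2) : E3 →L[ℝ] ℝ).smulRight (EuclideanSpace.single (i + 2) 1))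
      : E3 →L[ℝ] E3)
  norm_map' y := by
    rw [← sq_eq_sq₀ (norm_nonneg _) (norm_nonneg _), norm_sq_three, norm_sq_three]
    have h := Real.sin_sq_add_cos_sq θ
    fin_cases i <;> simp [rotField_apply]
    · linear_combination (y 1 ^ 2 + y 2 ^ 2) * h
    · linear_combination (y 0 ^ 2 + y 2 ^ 2) * h
    · linear_combination (y 0 ^ 2 + y 1 ^ 2) * h

/-- The rotation about the `i`-th axis by the angle `θ`, as an equivalence. -/
def rot (i : Fin 3) (θ : ℝ) : E3 ≃ₗᵢ[ℝ] E3 := (rotLin i θ).toLinearIsometryEquiv rfl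

lemma rot_apply (i : Fin 3) (θ : ℝ) (y : E3) :
    rot i θ y = y + Real.sin θ • rotField i y + (Real.cos θ - 1) •
      (y (i + 1) • EuclideanSpace.single (i + 1) (1 : ℝ) +
        y (i + 2) • EuclideanSpace.single (i + 2) (1 : ℝ)) := by
  simp [rot, rotLin]

lemma rot_zero (i : Fin 3) (y : E3) : rot i 0 y = y := by simp [rot_apply]

lemma hasDerivAt_rot (i : Fin 3) (θ : ℝ) (y : E3) :
    HasDerivAt (fun t => rot i t y) (rotField i (rot i θ y)) θ := by
  have h := (((Real.hasDerivAt_sin θ).smul_const (rotField i y)).const_add y).add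
    (((Real.hasDerivAt_cos θ).sub_const 1).smul_const
      (y (i + 1) • EuclideanSpace.single (i + 1) (1 : ℝ) +
        y (i + 2) • EuclideanSpace.single (i + 2) (1 : ℝ)))
  simp_rw [rot_apply]
  refine h.congr_deriv ?_
  ext j
  fin_cases i <;> fin_cases j <;> simp [rotField_apply] <;> ring

instance : IsProbabilityMeasure σ := by
  constructor
  rw [σ, Measure.smul_apply, smul_eq_mul]
  refine ENNReal.inv_mul_cancel ?_ (measure_ne_top _ _)
  rw [Ne, Measure.measure_univ_eq_zero]
  exact Measure.toSphere_ne_zero _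

/-- The action of a linear isometry on the sphere. -/
def sphereMap (R : E3 ≃ₗᵢ[ℝ] E3) (x : S2) : S2 := ⟨R x, by simp⟩

lemma sphereMap_injective (R : E3 ≃ₗᵢ[ℝ] E3) : Function.Injective (sphereMap R) :=
  fun _ _ h => Subtype.ext (R.injective (Subtype.ext_iff.1 h))

lemma continuous_sphereMap (R : E3 ≃ₗᵢ[ℝ] E3) : Continuous (sphereMap R) :=
  (R.continuous.comp continuous_subtype_val).subtype_mk _

/-- `toSphere` measures a set by the volume of the cone over it. The cone over a preimage is the
preimage of the cone, and linear isometries preserve volume. -/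
lemma measurePreserving_sphereMap (R : E3 ≃ₗᵢ[ℝ] E3) : MeasurePreserving (sphereMap R) σ σ := by
  refine ⟨(continuous_sphereMap R).measurable, ?_⟩
  ext s hs
  have hm : MeasurableSet (sphereMap R ⁻¹' s) := (continuous_sphereMap R).measurable hs
  rw [Measure.map_apply (continuous_sphereMap R).measurable hs]
  simp only [σ, Measure.smul_apply, Measure.toSphere_apply' _ hs, Measure.toSphere_apply' _ hm]
  have h : Ioo (0 : ℝ) 1 • (Subtype.val '' (sphereMap R ⁻¹' s)) =
      R ⁻¹' (Ioo (0 : ℝ) 1 • (Subtype.val '' s)) := by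
    ext v
    simp only [Set.mem_smul, Set.mem_preimage, Set.mem_image]
    constructor
    · rintro ⟨r, hr, _, ⟨x, hx, rfl⟩, rfl⟩
      exact ⟨r, hr, _, ⟨_, hx, rfl⟩, by simp [sphereMap]⟩
    · rintro ⟨r, hr, _, ⟨x, hx, rfl⟩, h⟩
      refine ⟨r, hr, _, ⟨⟨R.symm x, by simp⟩, ?_, rfl⟩, ?_⟩
      · simpa [sphereMap] using hx
      · apply R.injective
        simpa using h
  rw [h]
  congr 2
  exact (R.measurePreserving).measure_preimage_emb R.toHomeomorph.measurableEmbedding _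

lemma integrable_of_continuous {F : Type*} [NormedAddCommGroup F] {f : S2 → F} (hf : Continuous f) :
    Integrable f σ :=
  hf.integrable_of_hasCompactSupport (HasCompactSupport.of_compactSpace f)

/-- Infinitesimal rotations integrate to zero over the sphere. -/
lemma integral_fderiv_rotField (i : Fin 3) {φ : E3 → ℝ} (hφ : ContDiff ℝ 1 φ) :
    ∫ y : S2, fderiv ℝ φ y (rotField i y) ∂σ = 0 := by
  have hd : Differentiable ℝ φ := hφ.differentiable (by norm_num)
  have hc : Continuous fun y : E3 => fderiv ℝ φ y (rotField i y) :=
    (hφ.continuous_fderiv (by norm_num)).clm_apply (rotField i).continuous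
  have hcS : Continuous fun y : S2 => fderiv ℝ φ y (rotField i y) := hc.comp continuous_subtype_val
  obtain ⟨C, hC⟩ := (isCompact_univ (X := S2)).exists_bound_of_continuousOn hcS.continuousOn
  -- Differentiate the integral of φ over the rotated sphere, which is constant in the angle.
  -- Rotated points stay on the sphere, so the supremum `C` dominates for every angle.
  have key := (hasDerivAt_integral_of_dominated_loc_of_deriv_le (μ := σ) (x₀ := (0 : ℝ))
    (F := fun t (y : S2) => φ (rot i t y))
    (F' := fun t (y : S2) => fderiv ℝ φ (rot i t y) (rotField i (rot i t y)))
    (bound := fun _ => C) (s := univ) univ_mem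
    (Eventually.of_forall fun t => (hφ.continuous.comp
      ((rot i t).continuous.comp continuous_subtype_val)).aestronglyMeasurable)
    (integrable_of_continuous (hφ.continuous.comp
      ((rot i 0).continuous.comp continuous_subtype_val)))
    (hc.comp ((rot i 0).continuous.comp continuous_subtype_val)).aestronglyMeasurable
    (Eventually.of_forall fun y t _ => hC (sphereMap (rot i t) y) trivial)
    (integrable_const _)
    (Eventually.of_forall fun y t _ =>
      (hd _).hasFDerivAt.comp_hasDerivAt t (hasDerivAt_rot i t y))).2
  have hconst : (fun t : ℝ => ∫ y : S2, φ (rot i t y) ∂σ) = fun _ => ∫ y : S2, φ y ∂σ := by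
    funext t
    have := (measurePreserving_sphereMap (rot i t)).integral_comp
      (g := fun y : S2 => φ y) ?_
    · exact this
    · exact ((continuous_sphereMap _).isClosedEmbedding (sphereMap_injective _)).measurableEmbedding
  rw [hconst] at key
  have := key.unique (hasDerivAt_const (0 : ℝ) _)
  simpa only [rot_zero] using this

/-! ### Weak derivatives along infinitesimal rotations -/

section WeakDerivatives

variable {E : Type*} [NormedAddCommGroup E] [NormedSpace ℝ E]

/-- The functions `h i` are the weak derivatives of `f` along the infinitesimal rotations. -/
structure HasRotDeriv (f : S2 → E) (h : Fin 3 → S2 → E) : Prop where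
  integrable_fun : Integrable f σ
  integrable_deriv : ∀ i, Integrable (h i) σ
  integral_eq : ∀ i, ∀ φ : E3 → ℝ, ContDiff ℝ (⊤ : ℕ∞) φ →
    ∫ y : S2, fderiv ℝ φ y (rotField i y) • f y ∂σ = - ∫ y : S2, φ y • h i y ∂σ

lemma hasRotDeriv_one : HasRotDeriv (fun _ : S2 => (1 : ℝ)) 0 where
  integrable_fun := integrable_const _
  integrable_deriv _ := integrable_zero _ _ _
  integral_eq i φ hφ := by
    have := integral_fderiv_rotField i (hφ.of_le (by exact_mod_cast le_top))
    simpa using this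

/-- `rotField i` has trace zero and is orthogonal to the position vector, so only the derivative of
φ survives. This turns vector test fields into scalar test functions. -/
lemma sphereDiv_smul_rotField (i : Fin 3) {φ : E3 → ℝ} (hφ : Differentiable ℝ φ) (y : S2) :
    sphereDiv (fun v => φ v • rotField i v) y = fderiv ℝ φ y (rotField i y) := by
  have hd : fderiv ℝ (fun v => φ v • rotField i v) y =
      φ y • rotField i + (fderiv ℝ φ y).smulRight (rotField i y) :=
    ((hφ y).hasFDerivAt.smul (rotField i).hasFDerivAt).fderiv
  have hsum : ∑ j, fderiv ℝ φ y (EuclideanSpace.single j 1) * rotField i y j =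
      fderiv ℝ φ y (rotField i y) := by
    conv_rhs => rw [← (EuclideanSpace.basisFun (Fin 3) ℝ).sum_repr (rotField i y)]
    simp [mul_comm]
  simp only [sphereDiv, hd, add_apply, smul_apply,
    ContinuousLinearMap.smulRight_apply, PiLp.add_apply, PiLp.smul_apply, smul_eq_mul,
    Finset.sum_add_distrib, ← Finset.mul_sum, trace_rotField, hsum, inner_add_left,
    real_inner_smul_left, inner_rotField_self]
  simp

end WeakDerivatives

/-! ### From the weak gradient to rotational derivatives -/

section Gradient

variable {𝕜 : Type*} [RCLike 𝕜]

/-- The components of a vector field along the infinitesimal rotations. -/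
def rotComponent (G : S2 → EuclideanSpace 𝕜 (Fin 3)) (i : Fin 3) (y : S2) : 𝕜 :=
  ∑ j, rotField i y j • G y j

lemma continuous_rotField_apply (i j : Fin 3) : Continuous fun y : S2 => rotField i (y : E3) j := by
  fun_prop

lemma abs_rotField_apply_le (i j : Fin 3) (y : S2) : |rotField i (y : E3) j| ≤ 1 := by
  have hk (k : Fin 3) : |(y : E3) k| ≤ 1 := by
    simpa using PiLp.norm_apply_le (y : E3) k
  fin_cases i <;> fin_cases j <;> simp [rotField_apply, hk]

lemma memLp_rotComponent {p : ℝ≥0∞} {G : S2 → EuclideanSpace 𝕜 (Fin 3)} (hG : MemLp G p σ)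
    (i : Fin 3) : MemLp (rotComponent G i) p σ := by
  refine memLp_finsetSum _ fun j _ => ?_
  have hGj : MemLp (fun y => G y j) p σ :=
    (EuclideanSpace.proj j : EuclideanSpace 𝕜 (Fin 3) →L[𝕜] 𝕜).comp_memLp' hG
  refine hGj.of_le ((continuous_rotField_apply i j).aestronglyMeasurable.smul hGj.1) ?_
  refine Eventually.of_forall fun y => ?_
  rw [norm_smul]
  exact mul_le_of_le_one_left (norm_nonneg _) (abs_rotField_apply_le i j y)

/-- The components are the coordinates of y × G, so this is Lagrange's identity |y × G|² = |y|²|G|²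
− (y·G)², applied to real and imaginary parts separately. -/
lemma sum_norm_rotComponent_sq {G : S2 → EuclideanSpace 𝕜 (Fin 3)} {y : S2}
    (h : ∑ i, y.1 i • G y i = 0) : ∑ i, ‖rotComponent G i y‖ ^ 2 = ‖G y‖ ^ 2 := by
  have h1 := S2.norm_sq y
  have hre := congrArg RCLike.re h
  have him := congrArg RCLike.im h
  simp only [Fin.sum_univ_three, map_add, RCLike.smul_re, RCLike.smul_im, map_zero] at hre him
  simp only [EuclideanSpace.norm_sq_eq, rotComponent, Fin.sum_univ_three, RCLike.norm_sq_eq_def,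
    rotField_apply, map_add, RCLike.smul_re, RCLike.smul_im]
  simp
  linear_combination (RCLike.re (G y 0) ^ 2 + RCLike.im (G y 0) ^ 2 + RCLike.re (G y 1) ^ 2 +
    RCLike.im (G y 1) ^ 2 + RCLike.re (G y 2) ^ 2 + RCLike.im (G y 2) ^ 2) * h1 -
    (y.1 0 * RCLike.re (G y 0) + y.1 1 * RCLike.re (G y 1) + y.1 2 * RCLike.re (G y 2)) * hre -
    (y.1 0 * RCLike.im (G y 0) + y.1 1 * RCLike.im (G y 1) + y.1 2 * RCLike.im (G y 2)) * him

lemma IsWeakGradient.hasRotDeriv {f : S2 → 𝕜} {G : S2 → EuclideanSpace 𝕜 (Fin 3)}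
    (hG : IsWeakGradient f G) : HasRotDeriv f (rotComponent G) where
  integrable_fun := hG.integrable_fun
  integrable_deriv i :=
    memLp_one_iff_integrable.1 (memLp_rotComponent (memLp_one_iff_integrable.2 hG.integrable_grad) i)
  integral_eq i φ hφ := by
    have h := hG.integral_div (fun v => φ v • rotField i v) (hφ.smul (rotField i).contDiff)
      (fun x => by rw [real_inner_smul_left, inner_rotField_self, mul_zero])
    simp only [sphereDiv_smul_rotField i (hφ.differentiable (by simp))] at h
    rw [h]
    simp [rotComponent, Finset.smul_sum, smul_smul]

end Gradient

/-! ### The zonal kernels and their Laplacian recursion -/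

section Kernel

/-- The zonal kernel `|K_N|² / N` of the spherical ensemble with `N = m + 1` points, as a function
of the inner product of the two points. -/
def zonal (m : ℕ) (t : ℝ) : ℝ := (m + 1) * ((1 + t) / 2) ^ m

/-- The derivative of `zonal (m + 1)`. -/
def zonalDeriv (m : ℕ) (t : ℝ) : ℝ := (m + 2) * (m + 1) / 2 * ((1 + t) / 2) ^ m

lemma contDiff_zonal (m : ℕ) : ContDiff ℝ (⊤ : ℕ∞) (zonal m) := by unfold zonal; fun_prop

lemma contDiff_zonalDeriv (m : ℕ) : ContDiff ℝ (⊤ : ℕ∞) (zonalDeriv m) := by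
  unfold zonalDeriv; fun_prop

lemma hasDerivAt_affine_pow (m : ℕ) (t : ℝ) :
    HasDerivAt (fun t : ℝ => ((1 + t) / 2) ^ m) (m * ((1 + t) / 2) ^ (m - 1) * (1 / 2)) t :=
  (((hasDerivAt_id t).const_add 1).div_const 2).pow m

lemma hasDerivAt_zonal (m : ℕ) (t : ℝ) : HasDerivAt (zonal (m + 1)) (zonalDeriv m t) t := by
  refine ((hasDerivAt_affine_pow (m + 1) t).const_mul ((m + 1 : ℕ) + 1 : ℝ)).congr_deriv ?_
  simp only [zonalDeriv, Nat.add_sub_cancel]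
  push_cast
  ring

/-- The left side is the Laplace–Beltrami operator on functions of t = ⟨x,y⟩. With u = (1+t)/2 it is
d/du (u(1−u) d/du), which sends u^n to n²u^(n−1) − n(n+1)u^n; take n = m + 1. -/
lemma zonal_laplacian (m : ℕ) (t : ℝ) : ∃ d, HasDerivAt (zonalDeriv m) d t ∧
    d * (1 - t ^ 2) - 2 * t * zonalDeriv m t = (m + 2) * (m + 1) * (zonal m t - zonal (m + 1) t) := by
  refine ⟨_, (hasDerivAt_affine_pow m t).const_mul ((m + 2) * (m + 1) / 2 : ℝ), ?_⟩
  simp only [zonal, zonalDeriv]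
  -- The exponent `m - 1` truncates at zero, so the constant derivative is treated apart.
  rcases m with _ | m
  · simp; ring
  · simp only [Nat.add_sub_cancel, pow_succ]; push_cast; ring

/-- The summands are the squared coordinates of y × x; Lagrange's identity again. -/
lemma sum_inner_rotField_sq (x y : S2) :
    ∑ i, ⟪(x : E3), rotField i y⟫ ^ 2 = 1 - ⟪(x : E3), (y : E3)⟫ ^ 2 := by
  have hx := S2.norm_sq x
  have hy := S2.norm_sq y
  simp only [inner_eq_three, Fin.sum_univ_three, rotField_apply]
  simp
  linear_combination ((y : E3) 0 ^ 2 + (y : E3) 1 ^ 2 + (y : E3) 2 ^ 2) * hx + hy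

lemma sum_inner_rotField_rotField (x y : E3) :
    ∑ i, ⟪x, rotField i (rotField i y)⟫ = - 2 * ⟪x, y⟫ := by
  simp only [inner_eq_three, Fin.sum_univ_three, rotField_apply]
  simp
  ring

lemma fderiv_zonal (m : ℕ) (x y v : E3) :
    fderiv ℝ (fun y => zonal (m + 1) ⟪x, y⟫) y v = zonalDeriv m ⟪x, y⟫ * ⟪x, v⟫ := by
  have := (hasDerivAt_zonal m ⟪x, y⟫).comp_hasFDerivAt y (innerSL ℝ x).hasFDerivAt
  have h2 : HasFDerivAt (fun y => zonal (m + 1) ⟪x, y⟫) (zonalDeriv m ⟪x, y⟫ • innerSL ℝ x) y := this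
  rw [h2.fderiv]
  simp

lemma contDiff_zonal_inner (m : ℕ) (x : E3) :
    ContDiff ℝ (⊤ : ℕ∞) fun y : E3 => zonal m ⟪x, y⟫ :=
  (contDiff_zonal m).comp (innerSL ℝ x).contDiff

lemma contDiff_zonalDeriv_inner (m : ℕ) (x : E3) (i : Fin 3) :
    ContDiff ℝ (⊤ : ℕ∞) fun y : E3 => zonalDeriv m ⟪x, y⟫ * ⟪x, rotField i y⟫ :=
  ((contDiff_zonalDeriv m).comp (innerSL ℝ x).contDiff).mul
    ((innerSL ℝ x).contDiff.comp (rotField i).contDiff)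

/-- The sum of the squared infinitesimal rotations is the spherical Laplacian: the first-order terms
squared sum to 1 − t², the second-order ones to −2t. -/
lemma sum_fderiv_zonalDeriv (m : ℕ) (x y : S2) :
    ∑ i, fderiv ℝ (fun y : E3 => zonalDeriv m ⟪(x : E3), y⟫ * ⟪(x : E3), rotField i y⟫) y
      (rotField i y) =
    (m + 2) * (m + 1) * (zonal m ⟪(x : E3), (y : E3)⟫ - zonal (m + 1) ⟪(x : E3), (y : E3)⟫) := by
  obtain ⟨d, hd, hdt⟩ := zonal_laplacian m ⟪(x : E3), (y : E3)⟫
  have h (i : Fin 3) :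
      fderiv ℝ (fun y : E3 => zonalDeriv m ⟪(x : E3), y⟫ * ⟪(x : E3), rotField i y⟫) y
        (rotField i y) = d * ⟪(x : E3), rotField i y⟫ ^ 2 +
          zonalDeriv m ⟪(x : E3), (y : E3)⟫ * ⟪(x : E3), rotField i (rotField i y)⟫ := by
    have h1 : HasFDerivAt (fun y => zonalDeriv m ⟪(x : E3), y⟫) (d • innerSL ℝ (x : E3)) (y : E3) :=
      hd.comp_hasFDerivAt (y : E3) (innerSL ℝ (x : E3)).hasFDerivAt
    have h2 : HasFDerivAt (fun y => ⟪(x : E3), rotField i y⟫)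
        ((innerSL ℝ (x : E3)).comp (rotField i)) (y : E3) :=
      ((innerSL ℝ (x : E3)).comp (rotField i)).hasFDerivAt
    have h3 : HasFDerivAt (fun y => zonalDeriv m ⟪(x : E3), y⟫ * ⟪(x : E3), rotField i y⟫) _
      (y : E3) := h1.mul h2
    rw [h3.fderiv]
    simp
    ring
  simp only [h, Finset.sum_add_distrib, ← Finset.mul_sum, sum_inner_rotField_sq,
    sum_inner_rotField_rotField, ← hdt]
  ring

/-- The zonal kernel as a function of two points on the sphere. -/
def zonalKernel (m : ℕ) (x y : S2) : ℝ := zonal m ⟪(x : E3), (y : E3)⟫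

/-- The derivative of `zonalKernel (m + 1) x` along an infinitesimal rotation. -/
def zonalDerivKernel (m : ℕ) (i : Fin 3) (x y : S2) : ℝ :=
  zonalDeriv m ⟪(x : E3), (y : E3)⟫ * ⟪(x : E3), rotField i y⟫

/-- The zonal kernels solve a heat-type recursion, tested against a function with weak
derivatives. -/
lemma HasRotDeriv.integral_zonal_sub {E : Type*} [NormedAddCommGroup E] [NormedSpace ℝ E]
    {f : S2 → E} {h : Fin 3 → S2 → E} (hf : HasRotDeriv f h) (m : ℕ) (x : S2) :
    ∫ y : S2, ((m + 2) * (m + 1) * (zonalKernel m x y -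
        zonalKernel (m + 1) x y)) • f y ∂σ =
      - ∑ i, ∫ y : S2, zonalDerivKernel m i x y • h i y ∂σ := by
  simp only [zonalKernel, zonalDerivKernel]
  have h1 (i : Fin 3) := hf.integral_eq i _ (contDiff_zonalDeriv_inner m x i)
  rw [← Finset.sum_neg_distrib, ← Finset.sum_congr rfl fun i _ => h1 i, ← integral_finsetSum]
  · simp only [← Finset.sum_smul, sum_fderiv_zonalDeriv]
  · intro i _
    have hc : Continuous fun y : S2 => fderiv ℝ (fun y : E3 => zonalDeriv m ⟪(x : E3), y⟫ *
        ⟪(x : E3), rotField i y⟫) y (rotField i y) :=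
      (((contDiff_zonalDeriv_inner m x i).continuous_fderiv (by simp)).clm_apply
        (rotField i).continuous).comp continuous_subtype_val
    obtain ⟨C, hC⟩ := (isCompact_univ (X := S2)).exists_bound_of_continuousOn hc.continuousOn
    exact hf.integrable_fun.bdd_smul C hc.aestronglyMeasurable
      (Eventually.of_forall fun y => hC y trivial)

lemma HasRotDeriv.integral_zonal_smul {E : Type*} [NormedAddCommGroup E] [NormedSpace ℝ E]
    {f : S2 → E} {h : Fin 3 → S2 → E} (hf : HasRotDeriv f h) (m : ℕ) (x : S2) (i : Fin 3) :
    ∫ y : S2, zonalDerivKernel m i x y • f y ∂σ =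
      - ∫ y : S2, zonalKernel (m + 1) x y • h i y ∂σ := by
  simpa only [fderiv_zonal, zonalKernel, zonalDerivKernel] using hf.integral_eq i _ (contDiff_zonal_inner (m + 1) x)

/-- Tested against the constant 1, whose derivatives vanish, the recursion makes the integral
independent of m; for m = 0 the kernel is 1. -/
lemma integral_zonal (m : ℕ) (x : S2) : ∫ y : S2, zonalKernel m x y ∂σ = 1 := by
  have hc (m : ℕ) : Integrable (fun y : S2 => zonalKernel m x y) σ :=
    integrable_of_continuous ((contDiff_zonal_inner m x).continuous.comp continuous_subtype_val)
  induction m with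
  | zero => simp [zonalKernel, zonal]
  | succ m ih =>
    have := hasRotDeriv_one.integral_zonal_sub m x
    simp only [smul_eq_mul, mul_one, Pi.zero_apply, mul_zero, integral_zero, Finset.sum_const_zero,
      neg_zero, integral_const_mul, integral_sub (hc m) (hc (m + 1)), ih] at this
    rcases mul_eq_zero.1 this with h | h
    · exact absurd h (by positivity)
    · linarith

lemma zonal_nonneg (m : ℕ) (x y : S2) : 0 ≤ zonalKernel m x y := by
  have : -(‖(x : E3)‖ * ‖(y : E3)‖) ≤ ⟪(x : E3), (y : E3)⟫ :=
    (abs_le.1 (abs_real_inner_le_norm (x : E3) (y : E3))).1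
  have hx : ‖(x : E3)‖ = 1 := by simp
  have hy : ‖(y : E3)‖ = 1 := by simp
  rw [hx, hy] at this
  unfold zonalKernel zonal
  have : 0 ≤ (1 + ⟪(x : E3), (y : E3)⟫) / 2 := by linarith
  positivity

end Kernel

/-! ### Quadratic forms of the zonal kernels -/

section Forms

variable {E : Type*} [NormedAddCommGroup E] [InnerProductSpace ℝ E]

/-- The bilinear form with kernel `K` on functions on the sphere. -/
def kernelForm (K : S2 → S2 → ℝ) (f g : S2 → E) : ℝ :=
  ∫ p : S2 × S2, K p.1 p.2 * ⟪f p.1, g p.2⟫ ∂(σ.prod σ)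

lemma integrable_inner_prod {f g : S2 → E} (hf : Integrable f σ) (hg : Integrable g σ) :
    Integrable (fun p : S2 × S2 => ⟪f p.1, g p.2⟫) (σ.prod σ) :=
  hf.op_fst_snd (op := fun a b : E => inner ℝ a b) (by fun_prop)
    ⟨1, fun a b => by simpa using norm_inner_le_norm (𝕜 := ℝ) a b⟩ hg

lemma integrable_kernelForm {K : S2 → S2 → ℝ} (hK : Continuous fun p : S2 × S2 => K p.1 p.2)
    {f g : S2 → E} (hf : Integrable f σ) (hg : Integrable g σ) :
    Integrable (fun p : S2 × S2 => K p.1 p.2 * ⟪f p.1, g p.2⟫) (σ.prod σ) := by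
  obtain ⟨C, hC⟩ := (isCompact_univ (X := S2 × S2)).exists_bound_of_continuousOn hK.continuousOn
  exact (integrable_inner_prod hf hg).bdd_mul hK.aestronglyMeasurable
    (Eventually.of_forall fun p => hC p trivial)

lemma integrable_kernel_smul {K : S2 → S2 → ℝ} (hK : Continuous fun p : S2 × S2 => K p.1 p.2)
    {f : S2 → E} (hf : Integrable f σ) (x : S2) : Integrable (fun y => K x y • f y) σ := by
  have hKx : Continuous (K x) := hK.comp (Continuous.prodMk_right x)
  obtain ⟨C, hC⟩ := (isCompact_univ (X := S2)).exists_bound_of_continuousOn hKx.continuousOn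
  exact hf.bdd_smul C hKx.aestronglyMeasurable (Eventually.of_forall fun p => hC p trivial)

lemma kernelForm_swap (K : S2 → S2 → ℝ) (f g : S2 → E) :
    kernelForm K f g = kernelForm (fun x y => K y x) g f := by
  rw [kernelForm, kernelForm, ← integral_prod_swap]
  simp only [Prod.fst_swap, Prod.snd_swap, real_inner_comm]

lemma kernelForm_sub_left {K : S2 → S2 → ℝ} (hK : Continuous fun p : S2 × S2 => K p.1 p.2)
    {f f' g : S2 → E} (hf : Integrable f σ) (hf' : Integrable f' σ) (hg : Integrable g σ) :
    kernelForm K (f - f') g = kernelForm K f g - kernelForm K f' g := by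
  rw [kernelForm, kernelForm, kernelForm,
    ← integral_sub (integrable_kernelForm hK hf hg) (integrable_kernelForm hK hf' hg)]
  simp only [Pi.sub_apply, inner_sub_left, mul_sub]

lemma kernelForm_sub_right {K : S2 → S2 → ℝ} (hK : Continuous fun p : S2 × S2 => K p.1 p.2)
    {f g g' : S2 → E} (hf : Integrable f σ) (hg : Integrable g σ) (hg' : Integrable g' σ) :
    kernelForm K f (g - g') = kernelForm K f g - kernelForm K f g' := by
  rw [kernelForm, kernelForm, kernelForm,
    ← integral_sub (integrable_kernelForm hK hf hg) (integrable_kernelForm hK hf hg')]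
  simp only [Pi.sub_apply, inner_sub_right, mul_sub]

variable [CompleteSpace E]

lemma inner_integral_kernel {K : S2 → S2 → ℝ} (hK : Continuous fun p : S2 × S2 => K p.1 p.2)
    {f : S2 → E} (hf : Integrable f σ) (x : S2) (v : E) :
    ⟪v, ∫ y, K x y • f y ∂σ⟫ = ∫ y, K x y * ⟪v, f y⟫ ∂σ := by
  rw [← integral_inner (integrable_kernel_smul hK hf x)]
  simp only [real_inner_smul_right]

lemma kernelForm_eq {K : S2 → S2 → ℝ} (hK : Continuous fun p : S2 × S2 => K p.1 p.2)
    {f g : S2 → E} (hf : Integrable f σ) (hg : Integrable g σ) :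
    kernelForm K f g = ∫ x, ⟪f x, ∫ y, K x y • g y ∂σ⟫ ∂σ := by
  rw [kernelForm, integral_prod _ (integrable_kernelForm hK hf hg)]
  simp only [inner_integral_kernel hK hg]

lemma integrable_inner_integral {K : S2 → S2 → ℝ}
    (hK : Continuous fun p : S2 × S2 => K p.1 p.2)
    {f g : S2 → E} (hf : Integrable f σ) (hg : Integrable g σ) :
    Integrable (fun x => ⟪f x, ∫ y, K x y • g y ∂σ⟫) σ := by
  simpa only [inner_integral_kernel hK hg] using
    (integrable_kernelForm hK hf hg).integral_prod_left

lemma continuous_inner_S2 : Continuous fun p : S2 × S2 => ⟪(p.1 : E3), (p.2 : E3)⟫ := by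
  fun_prop

lemma continuous_zonal (m : ℕ) : Continuous fun p : S2 × S2 => zonalKernel m p.1 p.2 :=
  (contDiff_zonal m).continuous.comp continuous_inner_S2

lemma continuous_zonalDeriv (m : ℕ) (i : Fin 3) : Continuous fun p : S2 × S2 =>
    zonalDerivKernel m i p.1 p.2 :=
  ((contDiff_zonalDeriv m).continuous.comp continuous_inner_S2).mul (by fun_prop)

/-- The quadratic form of the zonal kernel. -/
def zonalForm (m : ℕ) (f : S2 → E) : ℝ :=
  kernelForm (zonalKernel m) f f

/-- Increments of the quadratic forms of the zonal kernels are quadratic forms in the weak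
derivatives. -/
lemma HasRotDeriv.zonalForm_succ_sub {f : S2 → E} {h : Fin 3 → S2 → E} (hf : HasRotDeriv f h)
    (m : ℕ) : (m + 2) * (m + 1) * (zonalForm (m + 1) f - zonalForm m f) =
      ∑ i, zonalForm (m + 1) (h i) := by
  have hfi := hf.integrable_fun
  have hD (i : Fin 3) : kernelForm (zonalDerivKernel m i) f (h i) =
        zonalForm (m + 1) (h i) := by
    -- `rotField i` is antisymmetric, so exchanging the two points only changes the sign. The
    -- derivative thereby falls on the remaining factor f in the second integration by parts.
    have hanti : (fun x y => zonalDerivKernel m i y x) = fun x y => - zonalDerivKernel m i x y := by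
      funext x y
      rw [zonalDerivKernel, inner_rotField_left, real_inner_comm, mul_neg, zonalDerivKernel]
    rw [kernelForm_swap, hanti,
      kernelForm_eq (continuous_zonalDeriv m i).neg (hf.integrable_deriv i) hfi]
    simp only [neg_smul, integral_neg, hf.integral_zonal_smul, neg_neg]
    rw [zonalForm, kernelForm_eq (continuous_zonal (m + 1)) (hf.integrable_deriv i)
      (hf.integrable_deriv i)]
  have hL : kernelForm (fun x y => (m + 2) * (m + 1) * (zonalKernel m x y -
      zonalKernel (m + 1) x y)) f f = - ∑ i, kernelForm (zonalDerivKernel m i) f (h i) := by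
    rw [kernelForm_eq (continuous_const.mul ((continuous_zonal m).sub (continuous_zonal (m + 1))))
      hfi hfi]
    simp only [hf.integral_zonal_sub, inner_neg_right, inner_sum, integral_neg]
    rw [integral_finsetSum _ fun i _ => integrable_inner_integral (continuous_zonalDeriv m i) hfi
      (hf.integrable_deriv i)]
    exact congrArg Neg.neg (Finset.sum_congr rfl fun i _ =>
      (kernelForm_eq (continuous_zonalDeriv m i) hfi (hf.integrable_deriv i)).symm)
  have hS : kernelForm (fun x y => (m + 2) * (m + 1) * (zonalKernel m x y -
      zonalKernel (m + 1) x y)) f f =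
      (m + 2) * (m + 1) * (zonalForm m f - zonalForm (m + 1) f) := by
    rw [zonalForm, zonalForm, kernelForm, kernelForm, kernelForm,
      ← integral_sub (integrable_kernelForm (continuous_zonal m) hfi hfi)
        (integrable_kernelForm (continuous_zonal (m + 1)) hfi hfi), ← integral_const_mul]
    congr 1
    funext p
    ring
  simp only [hD, hS] at hL
  linarith

lemma zonalForm_zero {f : S2 → E} (hf : Integrable f σ) :
    zonalForm 0 f = ‖∫ x, f x ∂σ‖ ^ 2 := by
  rw [zonalForm, kernelForm_eq (continuous_zonal 0) hf hf]
  simp only [zonalKernel, zonal]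
  simp only [pow_zero, mul_one, CharP.cast_eq_zero, zero_add, one_smul]
  simp_rw [real_inner_comm _ (f _)]
  rw [integral_inner hf, real_inner_self_eq_norm_sq]

/-- The positive definite kernel `(1 + ⟪x, y⟫) ^ m`. -/
def powKernel (m : ℕ) (x y : S2) : ℝ := (1 + ⟪(x : E3), (y : E3)⟫) ^ m

lemma continuous_powKernel (m : ℕ) : Continuous fun p : S2 × S2 => powKernel m p.1 p.2 :=
  (continuous_const.add continuous_inner_S2).pow m

/-- Since 1 + ⟨x,y⟩ = 1 + ∑ x_i y_i, the form of order m + 1 at f is the form of order m at f plus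
those at the coordinate multiples x_i f; hence the induction over all f. -/
lemma kernelForm_pow_nonneg (m : ℕ) {f : S2 → E} (hf : Integrable f σ) :
    0 ≤ kernelForm (powKernel m) f f := by
  have hc := continuous_powKernel
  induction m generalizing f with
  | zero =>
    have h1 : powKernel 0 = zonalKernel 0 := by
      funext x y
      simp [powKernel, zonalKernel, zonal]
    rw [h1]
    change 0 ≤ zonalForm 0 f
    rw [zonalForm_zero hf]
    positivity
  | succ m ih =>
    have hfi (i : Fin 3) : Integrable (fun x : S2 => (x : E3) i • f x) σ := by
      have hci : Continuous fun x : S2 => (x : E3) i := by fun_prop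
      obtain ⟨C, hC⟩ := (isCompact_univ (X := S2)).exists_bound_of_continuousOn hci.continuousOn
      exact hf.bdd_smul C hci.aestronglyMeasurable (Eventually.of_forall fun p => hC p trivial)
    have key : kernelForm (powKernel (m + 1)) f f =
        kernelForm (powKernel m) f f +
        ∑ i, kernelForm (powKernel m)
          (fun x : S2 => (x : E3) i • f x) (fun x : S2 => (x : E3) i • f x) := by
      simp only [kernelForm]
      rw [← integral_finsetSum _ fun i _ => integrable_kernelForm (hc m) (hfi i) (hfi i),
        ← integral_add (integrable_kernelForm (hc m) hf hf) (integrable_finsetSum _ fun i _ =>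
          integrable_kernelForm (hc m) (hfi i) (hfi i))]
      congr 1
      funext p
      simp only [powKernel, real_inner_smul_left, real_inner_smul_right, Fin.sum_univ_three, inner_eq_three]
      ring
    rw [key]
    exact add_nonneg (ih hf) (Finset.sum_nonneg fun i _ => ih (hfi i))

lemma zonalForm_nonneg (m : ℕ) {f : S2 → E} (hf : Integrable f σ) : 0 ≤ zonalForm m f := by
  have h : zonalForm m f =
      (m + 1) / 2 ^ m * kernelForm (powKernel m) f f := by
    rw [zonalForm, kernelForm, kernelForm, ← integral_const_mul]
    congr 1
    funext p
    simp only [powKernel, zonalKernel, zonal, div_pow]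
    ring
  rw [h]
  exact mul_nonneg (by positivity) (kernelForm_pow_nonneg m hf)

end Forms

/-! ### Zonal measures on pairs and their concentration on the diagonal -/

section ZonalMeasure

lemma zonalKernel_comm (m : ℕ) (x y : S2) : zonalKernel m x y = zonalKernel m y x := by
  rw [zonalKernel, real_inner_comm, zonalKernel]

lemma continuous_zonalKernel_left (m : ℕ) (x : S2) : Continuous (zonalKernel m x) :=
  (contDiff_zonal_inner m x).continuous.comp continuous_subtype_val

lemma lintegral_zonalKernel (m : ℕ) (x : S2) :
    ∫⁻ y, ENNReal.ofReal (zonalKernel m x y) ∂σ = 1 := by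
  rw [← ofReal_integral_eq_lintegral_ofReal
    (integrable_of_continuous (continuous_zonalKernel_left m x))
    (Eventually.of_forall fun y => zonal_nonneg m x y), integral_zonal, ENNReal.ofReal_one]

/-- The probability measure on pairs of points whose density is the zonal kernel. -/
def zonalMeasure (m : ℕ) : Measure (S2 × S2) :=
  (σ.prod σ).withDensity fun p => ENNReal.ofReal (zonalKernel m p.1 p.2)

lemma measurable_zonalDensity (m : ℕ) :
    Measurable fun p : S2 × S2 => ENNReal.ofReal (zonalKernel m p.1 p.2) :=
  (continuous_zonal m).measurable.ennreal_ofReal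

/-- The kernel has mass one in its second variable. Together with the analogous fact for `Prod.snd`,
this makes approximation errors in L^p uniform in m. -/
lemma measurePreserving_fst_zonalMeasure (m : ℕ) :
    MeasurePreserving Prod.fst (zonalMeasure m) σ := by
  refine ⟨measurable_fst, ?_⟩
  ext s hs
  rw [Measure.map_apply measurable_fst hs, zonalMeasure, withDensity_apply _ (measurable_fst hs),
    ← Set.prod_univ, ← Measure.prod_restrict, lintegral_prod _ (measurable_zonalDensity m).aemeasurable]
  simp [lintegral_zonalKernel]

lemma measurePreserving_snd_zonalMeasure (m : ℕ) :
    MeasurePreserving Prod.snd (zonalMeasure m) σ := by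
  refine ⟨measurable_snd, ?_⟩
  ext s hs
  rw [Measure.map_apply measurable_snd hs, zonalMeasure, withDensity_apply _ (measurable_snd hs),
    ← Set.univ_prod, ← Measure.prod_restrict,
    lintegral_prod_symm _ (measurable_zonalDensity m).aemeasurable]
  simp [lintegral_zonalKernel, zonalKernel_comm m _]

instance (m : ℕ) : IsProbabilityMeasure (zonalMeasure m) := by
  constructor
  have := (measurePreserving_fst_zonalMeasure m).measure_preimage MeasurableSet.univ.nullMeasurableSet
  simpa using this

lemma integral_zonalMeasure (m : ℕ) {F : Type*} [NormedAddCommGroup F] [NormedSpace ℝ F]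
    (g : S2 × S2 → F) :
    ∫ p, g p ∂(zonalMeasure m) = ∫ p, zonalKernel m p.1 p.2 • g p ∂(σ.prod σ) := by
  rw [zonalMeasure, integral_withDensity_eq_integral_toReal_smul (measurable_zonalDensity m)
    (Eventually.of_forall fun _ => ENNReal.ofReal_lt_top)]
  congr 1
  funext p
  rw [ENNReal.toReal_ofReal (zonal_nonneg m p.1 p.2)]

lemma integrable_of_continuous_prod {ν : Measure (S2 × S2)} [IsFiniteMeasure ν] {F : Type*}
    [NormedAddCommGroup F] {g : S2 × S2 → F} (hg : Continuous g) : Integrable g ν :=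
  hg.integrable_of_hasCompactSupport (HasCompactSupport.of_compactSpace g)

/-- Writing 1 − t = 2 − 2·(1+t)/2 expresses the density as 2k_m − (2(m+1)/(m+2)) k_{m+1}, and both
kernels have mass one. -/
lemma integral_one_sub_inner_zonalMeasure (m : ℕ) :
    ∫ p, (1 - ⟪(p.1 : E3), (p.2 : E3)⟫) ∂(zonalMeasure m) = 2 / (m + 2) := by
  have h1 (m : ℕ) : ∫ p : S2 × S2, zonalKernel m p.1 p.2 ∂(σ.prod σ) = 1 := by
    rw [integral_prod _ (integrable_of_continuous_prod (continuous_zonal m))]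
    simp [integral_zonal]
  have h2 (p : S2 × S2) : zonalKernel m p.1 p.2 • (1 - ⟪(p.1 : E3), (p.2 : E3)⟫) =
      2 * zonalKernel m p.1 p.2 - (2 * (m + 1) / (m + 2)) * zonalKernel (m + 1) p.1 p.2 := by
    have : (m + 2 : ℝ) ≠ 0 := by positivity
    simp only [zonalKernel, zonal, smul_eq_mul, pow_succ]
    push_cast
    field_simp
    ring
  rw [integral_zonalMeasure]
  simp only [h2]
  rw [integral_sub ((integrable_of_continuous_prod (continuous_zonal m)).const_mul _)
    ((integrable_of_continuous_prod (continuous_zonal (m + 1))).const_mul _), integral_const_mul,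
    integral_const_mul, h1, h1]
  have : (m + 2 : ℝ) ≠ 0 := by positivity
  field_simp
  ring

lemma inner_le_one_S2 (x y : S2) : ⟪(x : E3), (y : E3)⟫ ≤ 1 := by
  simpa using real_inner_le_norm (x : E3) (y : E3)

/-- The compact set where F ≥ ε misses the diagonal, so 1 − ⟨x,y⟩ has a positive minimum c there; C
= M/c works for a bound M of |F|. -/
lemma exists_le_add_mul_one_sub_inner {F : S2 × S2 → ℝ} (hF : Continuous F)
    (hd : ∀ x, F (x, x) = 0) {ε : ℝ} (hε : 0 < ε) :
    ∃ C : ℝ, ∀ p, F p ≤ ε + C * (1 - ⟪(p.1 : E3), (p.2 : E3)⟫) := by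
  have hK : IsCompact {p | ε ≤ F p} := (isClosed_le continuous_const hF).isCompact
  obtain ⟨M, hM⟩ := (isCompact_univ (X := S2 × S2)).exists_bound_of_continuousOn hF.continuousOn
  rcases Set.eq_empty_or_nonempty {p | ε ≤ F p} with he | hne
  · refine ⟨0, fun p => ?_⟩
    have : p ∉ {p | ε ≤ F p} := by simp [he]
    simp only [mem_ofPred_eq, not_le] at this
    linarith
  · obtain ⟨p₀, hp₀, hmin⟩ := hK.exists_isMinOn hne
      (continuous_const.sub continuous_inner_S2 : Continuous fun p : S2 × S2 =>
        1 - ⟪(p.1 : E3), (p.2 : E3)⟫).continuousOn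
    set c := 1 - ⟪(p₀.1 : E3), (p₀.2 : E3)⟫ with hc
    have hc0 : 0 < c := by
      rcases (inner_le_one_S2 p₀.1 p₀.2).lt_or_eq with h | h
      · linarith
      · have h' : (p₀.1 : E3) = p₀.2 := (inner_eq_one_iff_of_norm_eq_one (𝕜 := ℝ) (by simp) (by simp)).1 h
        have h'' : F p₀ = 0 := by
          rw [show p₀ = (p₀.1, p₀.1) from Prod.ext rfl (Subtype.ext h').symm]
          exact hd _
        have : ε ≤ F p₀ := hp₀
        linarith
    have hM0 : 0 ≤ M := (norm_nonneg _).trans (hM p₀ trivial)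
    refine ⟨M / c, fun p => ?_⟩
    by_cases hp : ε ≤ F p
    · have h1 : c ≤ 1 - ⟪(p.1 : E3), (p.2 : E3)⟫ := hmin hp
      have h2 : F p ≤ M := (le_abs_self _).trans (hM p trivial)
      have h3 : M / c * c ≤ M / c * (1 - ⟪(p.1 : E3), (p.2 : E3)⟫) :=
        mul_le_mul_of_nonneg_left h1 (by positivity)
      rw [div_mul_cancel₀ _ hc0.ne'] at h3
      linarith
    · have h1 := inner_le_one_S2 p.1 p.2
      have : 0 ≤ M / c * (1 - ⟪(p.1 : E3), (p.2 : E3)⟫) :=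
        mul_nonneg (by positivity) (by linarith)
      linarith

/-- The zonal measures concentrate on the diagonal. -/
lemma tendsto_integral_zonalMeasure {F : S2 × S2 → ℝ} (hF : Continuous F) (h0 : ∀ p, 0 ≤ F p)
    (hd : ∀ x, F (x, x) = 0) :
    Tendsto (fun m => ∫ p, F p ∂(zonalMeasure m)) atTop (𝓝 0) := by
  rw [Metric.tendsto_atTop]
  intro ε hε
  obtain ⟨C, hC⟩ := exists_le_add_mul_one_sub_inner hF hd (half_pos hε)
  have hle (m : ℕ) : ∫ p, F p ∂(zonalMeasure m) ≤ ε / 2 + C * (2 / (m + 2)) := by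
    have hi : Integrable (fun p : S2 × S2 => C * (1 - ⟪(p.1 : E3), (p.2 : E3)⟫)) (zonalMeasure m) :=
      integrable_of_continuous_prod
        (continuous_const.mul (continuous_const.sub continuous_inner_S2))
    refine (integral_mono (integrable_of_continuous_prod hF)
      ((integrable_const (ε / 2)).add hi) hC).trans ?_
    rw [integral_add' (integrable_const _) hi, integral_const_mul,
      integral_one_sub_inner_zonalMeasure]
    simp
  have hlim : Tendsto (fun m : ℕ => ε / 2 + C * (2 / ((m : ℝ) + 2))) atTop (𝓝 (ε / 2 + C * 0)) :=
    (((tendsto_natCast_atTop_atTop (R := ℝ)).atTop_add tendsto_const_nhds).const_div_atTop 2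
      |>.const_mul C).const_add _
  have hev := hlim.eventually_lt_const (show ε / 2 + C * 0 < ε by linarith)
  obtain ⟨n, hn⟩ := eventually_atTop.1 hev
  refine ⟨n, fun m hm => ?_⟩
  rw [Real.dist_eq, sub_zero, abs_of_nonneg (integral_nonneg h0)]
  exact (hle m).trans_lt (hn m hm)

variable {E : Type*} [NormedAddCommGroup E]

lemma eLpNorm_comp_fst_zonalMeasure (m : ℕ) {p : ℝ≥0∞} {f : S2 → E}
    (hf : AEStronglyMeasurable f σ) :
    eLpNorm (fun q : S2 × S2 => f q.1) p (zonalMeasure m) = eLpNorm f p σ :=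
  eLpNorm_comp_measurePreserving hf (measurePreserving_fst_zonalMeasure m)

lemma eLpNorm_comp_snd_zonalMeasure (m : ℕ) {p : ℝ≥0∞} {f : S2 → E}
    (hf : AEStronglyMeasurable f σ) :
    eLpNorm (fun q : S2 × S2 => f q.2) p (zonalMeasure m) = eLpNorm f p σ :=
  eLpNorm_comp_measurePreserving hf (measurePreserving_snd_zonalMeasure m)

lemma memLp_comp_fst_zonalMeasure (m : ℕ) {p : ℝ≥0∞} {f : S2 → E} (hf : MemLp f p σ) :
    MemLp (fun q : S2 × S2 => f q.1) p (zonalMeasure m) :=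
  hf.comp_measurePreserving (measurePreserving_fst_zonalMeasure m)

lemma memLp_comp_snd_zonalMeasure (m : ℕ) {p : ℝ≥0∞} {f : S2 → E} (hf : MemLp f p σ) :
    MemLp (fun q : S2 × S2 => f q.2) p (zonalMeasure m) :=
  hf.comp_measurePreserving (measurePreserving_snd_zonalMeasure m)

lemma eLpNorm_two_eq_ofReal_sqrt {α : Type*} [MeasurableSpace α] {ν : Measure α} {f : α → E}
    (hf : MemLp f 2 ν) : eLpNorm f 2 ν = ENNReal.ofReal (Real.sqrt (∫ x, ‖f x‖ ^ 2 ∂ν)) := by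
  rw [hf.eLpNorm_eq_integral_rpow_norm (by simp) (by simp), Real.sqrt_eq_rpow]
  simp

lemma tendsto_eLpNorm_sub_of_continuous {g : S2 → E} (hg : Continuous g) {p : ℝ≥0∞} (hp : p ≤ 2) :
    Tendsto (fun m => eLpNorm (fun q : S2 × S2 => g q.1 - g q.2) p (zonalMeasure m)) atTop
      (𝓝 0) := by
  have hc : Continuous fun q : S2 × S2 => g q.1 - g q.2 := by fun_prop
  have h1 := tendsto_integral_zonalMeasure (F := fun q => ‖g q.1 - g q.2‖ ^ 2) (by fun_prop)
    (fun _ => by positivity) (fun x => by simp)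
  have h2 := ENNReal.tendsto_ofReal ((Real.continuous_sqrt.tendsto 0).comp h1)
  rw [Real.sqrt_zero, ENNReal.ofReal_zero] at h2
  refine tendsto_of_tendsto_of_tendsto_of_le_of_le tendsto_const_nhds h2 (fun _ => zero_le)
    fun m => ?_
  refine (eLpNorm_le_eLpNorm_of_exponent_le hp hc.aestronglyMeasurable).trans ?_
  obtain ⟨C, hC⟩ := (isCompact_univ (X := S2 × S2)).exists_bound_of_continuousOn hc.continuousOn
  have hm : MemLp (fun q : S2 × S2 => g q.1 - g q.2) 2 (zonalMeasure m) :=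
    MemLp.of_bound hc.aestronglyMeasurable C (Eventually.of_forall fun p => hC p trivial)
  rw [eLpNorm_two_eq_ofReal_sqrt hm]
  rfl

lemma integral_norm_sq_comp_fst (m : ℕ) {f : S2 → E} (hf : MemLp f 2 σ) :
    ∫ q, ‖f q.1‖ ^ 2 ∂(zonalMeasure m) = ∫ x, ‖f x‖ ^ 2 ∂σ := by
  have h := measurePreserving_fst_zonalMeasure m
  conv_rhs => rw [← h.map_eq]
  rw [integral_map measurable_fst.aemeasurable]
  rw [h.map_eq]
  exact hf.1.norm.pow 2

lemma integral_norm_sq_comp_snd (m : ℕ) {f : S2 → E} (hf : MemLp f 2 σ) :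
    ∫ q, ‖f q.2‖ ^ 2 ∂(zonalMeasure m) = ∫ x, ‖f x‖ ^ 2 ∂σ := by
  have h := measurePreserving_snd_zonalMeasure m
  conv_rhs => rw [← h.map_eq]
  rw [integral_map measurable_snd.aemeasurable]
  rw [h.map_eq]
  exact hf.1.norm.pow 2

variable [NormedSpace ℝ E]

/-- Approximate f by a bounded continuous g. As both marginals are σ, replacing f by g costs the
same for every m. The forms need p = 2, the averages p = 1. -/
lemma tendsto_eLpNorm_sub_zonalMeasure {f : S2 → E} {p : ℝ≥0∞} (h1 : 1 ≤ p) (hp : p ≤ 2)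
    (hf : MemLp f p σ) :
    Tendsto (fun m => eLpNorm (fun q : S2 × S2 => f q.1 - f q.2) p (zonalMeasure m)) atTop
      (𝓝 0) := by
  rw [ENNReal.tendsto_nhds_zero]
  intro ε hε
  have hε3 : ε / 3 ≠ 0 := ENNReal.div_ne_zero.2 ⟨hε.ne', by simp⟩
  obtain ⟨g, hg, hgm⟩ := hf.exists_boundedContinuous_eLpNorm_sub_le
    (ne_top_of_le_ne_top (by simp) hp) hε3
  filter_upwards [ENNReal.tendsto_nhds_zero.1 (tendsto_eLpNorm_sub_of_continuous g.continuous hp)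
    (ε / 3) (pos_iff_ne_zero.2 hε3)] with m hm
  have hd := hf.sub hgm
  have e : (fun q : S2 × S2 => f q.1 - f q.2) = ((fun q : S2 × S2 => (f - g) q.1) +
      fun q : S2 × S2 => g q.1 - g q.2) - fun q : S2 × S2 => (f - g) q.2 := by
    funext q
    simp
  rw [e]
  have hc : Continuous fun q : S2 × S2 => g q.1 - g q.2 := by fun_prop
  refine (eLpNorm_sub_le ((memLp_comp_fst_zonalMeasure m hd).1.add hc.aestronglyMeasurable)
    (memLp_comp_snd_zonalMeasure m hd).1 h1).trans ?_
  refine (add_le_add_left (eLpNorm_add_le (memLp_comp_fst_zonalMeasure m hd).1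
    hc.aestronglyMeasurable h1) _).trans ?_
  rw [eLpNorm_comp_fst_zonalMeasure m hd.1, eLpNorm_comp_snd_zonalMeasure m hd.1]
  refine (add_le_add (add_le_add hg hm) hg).trans ?_
  rw [ENNReal.add_thirds]

end ZonalMeasure

/-! ### Convergence of the forms to the L² norm -/

section Limits

variable {E : Type*} [NormedAddCommGroup E] [InnerProductSpace ℝ E]

lemma zonalForm_eq_integral (m : ℕ) (f : S2 → E) :
    zonalForm m f = ∫ q, ⟪f q.1, f q.2⟫ ∂(zonalMeasure m) := by
  rw [integral_zonalMeasure]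
  rfl

/-- Polarization; each marginal contributes one copy of ‖f‖². -/
lemma zonalForm_eq_sub (m : ℕ) {f : S2 → E} (hf : MemLp f 2 σ) :
    zonalForm m f = ∫ x, ‖f x‖ ^ 2 ∂σ - (∫ q, ‖f q.1 - f q.2‖ ^ 2 ∂(zonalMeasure m)) / 2 := by
  have h1 := memLp_comp_fst_zonalMeasure m hf
  have h2 := memLp_comp_snd_zonalMeasure m hf
  have e (q : S2 × S2) : ⟪f q.1, f q.2⟫ =
      (‖f q.1‖ ^ 2 + ‖f q.2‖ ^ 2 - ‖f q.1 - f q.2‖ ^ 2) / 2 := by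
    rw [norm_sub_sq_real]
    ring
  have i1 := (memLp_two_iff_integrable_sq_norm h1.1).1 h1
  have i2 := (memLp_two_iff_integrable_sq_norm h2.1).1 h2
  have i3 : Integrable (fun q : S2 × S2 => ‖f q.1 - f q.2‖ ^ 2) (zonalMeasure m) :=
    (memLp_two_iff_integrable_sq_norm (h1.sub h2).1).1 (h1.sub h2)
  have hs : ∫ q, (‖f q.1‖ ^ 2 + ‖f q.2‖ ^ 2 - ‖f q.1 - f q.2‖ ^ 2) ∂(zonalMeasure m) =
      ∫ x, ‖f x‖ ^ 2 ∂σ + ∫ x, ‖f x‖ ^ 2 ∂σ - ∫ q, ‖f q.1 - f q.2‖ ^ 2 ∂(zonalMeasure m) := by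
    -- One copy of the L² norm is read off the first marginal, the other off the second.
    rw [← integral_norm_sq_comp_fst m hf]
    nth_rewrite 2 [integral_norm_sq_comp_fst m hf]
    rw [← integral_norm_sq_comp_snd m hf, ← integral_add i1 i2]
    exact integral_sub (i1.add i2) i3
  rw [zonalForm_eq_integral, funext e, integral_div, hs]
  generalize ∫ q, ‖f q.1 - f q.2‖ ^ 2 ∂(zonalMeasure m) = D
  generalize ∫ x, ‖f x‖ ^ 2 ∂σ = A
  ring

lemma zonalForm_le (m : ℕ) {f : S2 → E} (hf : MemLp f 2 σ) :
    zonalForm m f ≤ ∫ x, ‖f x‖ ^ 2 ∂σ := by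
  rw [zonalForm_eq_sub m hf]
  have : 0 ≤ ∫ q, ‖f q.1 - f q.2‖ ^ 2 ∂(zonalMeasure m) := integral_nonneg fun _ => by positivity
  linarith

lemma tendsto_zonalForm {f : S2 → E} (hf : MemLp f 2 σ) :
    Tendsto (fun m => zonalForm m f) atTop (𝓝 (∫ x, ‖f x‖ ^ 2 ∂σ)) := by
  have h := tendsto_eLpNorm_sub_zonalMeasure (by norm_num) le_rfl hf
  have hm (m : ℕ) : MemLp (fun q : S2 × S2 => f q.1 - f q.2) 2 (zonalMeasure m) :=
    (memLp_comp_fst_zonalMeasure m hf).sub (memLp_comp_snd_zonalMeasure m hf)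
  have h' := ((ENNReal.tendsto_toReal ENNReal.zero_ne_top).comp h).pow 2
  have e (m : ℕ) : zonalForm m f = ∫ x, ‖f x‖ ^ 2 ∂σ -
      (eLpNorm (fun q : S2 × S2 => f q.1 - f q.2) 2 (zonalMeasure m)).toReal ^ 2 / 2 := by
    rw [eLpNorm_two_eq_ofReal_sqrt (hm m), ENNReal.toReal_ofReal (Real.sqrt_nonneg _),
      Real.sq_sqrt (integral_nonneg fun _ => by positivity), zonalForm_eq_sub m hf]
  simp only [e]
  simpa using (h'.div_const 2).const_sub (∫ x, ‖f x‖ ^ 2 ∂σ)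

end Limits

/-! ### Square integrability and the rescaled defect -/

section Averages

variable {E : Type*} [NormedAddCommGroup E]

/-- The average of `f` against the zonal kernel. -/
def zonalAverage [NormedSpace ℝ E] (m : ℕ) (f : S2 → E) (x : S2) : E :=
  ∫ y, zonalKernel m x y • f y ∂σ

lemma memLp_zonalAverage [NormedSpace ℝ E] (m : ℕ) {f : S2 → E} (hf : Integrable f σ) {p : ℝ≥0∞} :
    MemLp (zonalAverage m f) p σ := by
  obtain ⟨C, hC⟩ :=
    (isCompact_univ (X := S2 × S2)).exists_bound_of_continuousOn (continuous_zonal m).continuousOn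
  have hm : AEStronglyMeasurable (zonalAverage m f) σ :=
    AEStronglyMeasurable.integral_prod_right' (f := fun p : S2 × S2 => zonalKernel m p.1 p.2 • f p.2)
      ((continuous_zonal m).aestronglyMeasurable.smul hf.1.comp_snd)
  refine MemLp.of_bound hm (C * ∫ y, ‖f y‖ ∂σ) (Eventually.of_forall fun x => ?_)
  rw [← integral_const_mul]
  refine norm_integral_le_of_norm_le (hf.norm.const_mul C) (Eventually.of_forall fun y => ?_)
  rw [norm_smul]
  exact mul_le_mul_of_nonneg_right (hC (x, y) trivial) (norm_nonneg _)

/-- As the kernel has mass one, the error at x is the average of f(y) − f(x) over y. -/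
lemma eLpNorm_zonalAverage_sub_le [NormedSpace ℝ E] [CompleteSpace E] (m : ℕ) {f : S2 → E}
    (hf : Integrable f σ) : eLpNorm (zonalAverage m f - f) 1 σ ≤
      eLpNorm (fun q : S2 × S2 => f q.1 - f q.2) 1 (zonalMeasure m) := by
  have hd : AEStronglyMeasurable (fun q : S2 × S2 => f q.1 - f q.2) (σ.prod σ) :=
    hf.1.comp_fst.sub hf.1.comp_snd
  rw [eLpNorm_one_eq_lintegral_enorm, eLpNorm_one_eq_lintegral_enorm, zonalMeasure,
    lintegral_withDensity_eq_lintegral_mul₀ (measurable_zonalDensity m).aemeasurable hd.enorm,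
    lintegral_prod _ ((measurable_zonalDensity m).aemeasurable.mul hd.enorm)]
  refine lintegral_mono fun x => ?_
  have hK := integrable_of_continuous (continuous_zonalKernel_left m x)
  have hKf : Integrable (fun y => zonalKernel m x y • f y) σ := by
    obtain ⟨C, hC⟩ := (isCompact_univ (X := S2)).exists_bound_of_continuousOn
      (continuous_zonalKernel_left m x).continuousOn
    exact hf.bdd_smul C hK.1 (Eventually.of_forall fun p => hC p trivial)
  have e : (zonalAverage m f - f) x = ∫ y, zonalKernel m x y • (f y - f x) ∂σ := by
    simp only [smul_sub]
    rw [integral_sub hKf (hK.smul_const (f x)), integral_smul_const, integral_zonal, one_smul]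
    rfl
  rw [e]
  refine (enorm_integral_le_lintegral_enorm _).trans (lintegral_mono fun y => ?_)
  rw [enorm_smul, Real.enorm_of_nonneg (zonal_nonneg m x y), ← enorm_neg (f y - f x), neg_sub]
  rfl

variable [InnerProductSpace ℝ E] [CompleteSpace E]

/-- Let A be the average of f. Positivity at f − A gives 0 ≤ Q(f) − 2‖A‖² + Q(A), because the mixed
terms equal ‖A‖²; moreover Q(A) ≤ ‖A‖². -/
lemma integral_norm_sq_zonalAverage_le (m : ℕ) {f : S2 → E} (hf : Integrable f σ) :
    ∫ x, ‖zonalAverage m f x‖ ^ 2 ∂σ ≤ zonalForm m f := by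
  have hg2 : MemLp (zonalAverage m f) 2 σ := memLp_zonalAverage m hf
  have hg : Integrable (zonalAverage m f) σ := memLp_one_iff_integrable.1 (memLp_zonalAverage m hf)
  have hc := continuous_zonal m
  have hgf : kernelForm (zonalKernel m) (zonalAverage m f) f =
      ∫ x, ‖zonalAverage m f x‖ ^ 2 ∂σ := by
    rw [kernelForm_eq hc hg hf]
    exact integral_congr_ae (Eventually.of_forall fun x => real_inner_self_eq_norm_sq _)
  have hfg : kernelForm (zonalKernel m) f (zonalAverage m f) =
      ∫ x, ‖zonalAverage m f x‖ ^ 2 ∂σ := by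
    rw [kernelForm_swap, ← hgf]
    congr 1
    funext x y
    exact zonalKernel_comm m y x
  have h := zonalForm_nonneg m (hf.sub hg)
  have hle := zonalForm_le m hg2
  rw [zonalForm] at h hle
  have e : kernelForm (zonalKernel m) (f - zonalAverage m f) (f - zonalAverage m f) =
      kernelForm (zonalKernel m) f f - kernelForm (zonalKernel m) f (zonalAverage m f) -
      (kernelForm (zonalKernel m) (zonalAverage m f) f -
        kernelForm (zonalKernel m) (zonalAverage m f) (zonalAverage m f)) := by
    rw [← kernelForm_sub_right hc hf hf hg, ← kernelForm_sub_right hc hg hf hg,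
      ← kernelForm_sub_left hc hf hg (hf.sub hg)]
  rw [e, hfg, hgf] at h
  rw [zonalForm]
  linarith

/-- An integrable function with bounded zonal forms is square integrable. -/
lemma memLp_two_of_zonalForm_le {f : S2 → E} (hf : Integrable f σ) {C : ℝ}
    (hC : ∀ m, zonalForm m f ≤ C) : MemLp f 2 σ := by
  have h1 : Tendsto (fun m => eLpNorm (zonalAverage m f - f) 1 σ) atTop (𝓝 0) :=
    tendsto_of_tendsto_of_tendsto_of_le_of_le tendsto_const_nhds
      (tendsto_eLpNorm_sub_zonalMeasure le_rfl (by norm_num) (memLp_one_iff_integrable.2 hf))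
      (fun _ => zero_le) fun m => eLpNorm_zonalAverage_sub_le m hf
  have hm (m : ℕ) : MemLp (zonalAverage m f) 2 σ := memLp_zonalAverage m hf
  -- A subsequence of the averages converges to f almost everywhere, so Fatou's lemma bounds the L²
  -- norm of f.
  obtain ⟨ns, -, hns⟩ := (tendstoInMeasure_of_tendsto_eLpNorm one_ne_zero (fun m => (hm m).1) hf.1
    h1).exists_seq_tendsto_ae
  refine ⟨hf.1, (Lp.eLpNorm_lim_le_liminf_eLpNorm (fun k => (hm (ns k)).1) f hns).trans_lt ?_⟩
  refine lt_of_le_of_lt (b := ENNReal.ofReal (Real.sqrt C)) ?_ ENNReal.ofReal_lt_top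
  refine liminf_le_of_le (by isBoundedDefault) fun b hb => ?_
  obtain ⟨k, hk⟩ := hb.exists
  refine hk.trans ?_
  rw [eLpNorm_two_eq_ofReal_sqrt (hm (ns k))]
  exact ENNReal.ofReal_le_ofReal
    (Real.sqrt_le_sqrt ((integral_norm_sq_zonalAverage_le _ hf).trans (hC _)))

lemma HasRotDeriv.zonalForm_succ {f : S2 → E} {h : Fin 3 → S2 → E} (hf : HasRotDeriv f h)
    (m : ℕ) : zonalForm (m + 1) f - zonalForm m f =
      (∑ i, zonalForm (m + 1) (h i)) * (1 / (m + 1) - 1 / (m + 2)) := by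
  rw [← hf.zonalForm_succ_sub m]
  field_simp
  ring

/-- A function with square integrable weak derivatives is square integrable. -/
lemma HasRotDeriv.memLp_two {f : S2 → E} {h : Fin 3 → S2 → E} (hf : HasRotDeriv f h)
    (hh : ∀ i, MemLp (h i) 2 σ) : MemLp f 2 σ := by
  set A := ∑ i, ∫ x, ‖h i x‖ ^ 2 ∂σ with hA
  have hA0 : 0 ≤ A := Finset.sum_nonneg fun i _ => integral_nonneg fun _ => by positivity
  have key (m : ℕ) : zonalForm m f ≤ zonalForm 0 f + A * (1 - 1 / (m + 1)) := by
    induction m with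
    | zero => simp
    | succ m ih =>
      have h1 := hf.zonalForm_succ m
      have h2 : ∑ i, zonalForm (m + 1) (h i) ≤ A :=
        Finset.sum_le_sum fun i _ => zonalForm_le (m + 1) (hh i)
      have h3 : (0 : ℝ) ≤ 1 / (m + 1) - 1 / (m + 2) :=
        sub_nonneg.2 (one_div_le_one_div_of_le (by positivity) (by linarith))
      have h4 := mul_le_mul_of_nonneg_right h2 h3
      push_cast
      rw [show (m : ℝ) + 1 + 1 = m + 2 by ring]
      linarith
  refine memLp_two_of_zonalForm_le hf.integrable_fun (C := zonalForm 0 f + A) fun m => ?_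
  refine (key m).trans ?_
  have : 0 ≤ A * (1 / (m + 1 : ℝ)) := by positivity
  linarith

/-- The rescaled defect of the zonal forms converges to the Dirichlet energy. -/
lemma HasRotDeriv.tendsto_defect {f : S2 → E} {h : Fin 3 → S2 → E} (hf : HasRotDeriv f h)
    (hh : ∀ i, MemLp (h i) 2 σ) :
    Tendsto (fun m : ℕ => (m + 1 : ℝ) * (∫ x, ‖f x‖ ^ 2 ∂σ - zonalForm m f)) atTop
      (𝓝 (∑ i, ∫ x, ‖h i x‖ ^ 2 ∂σ)) := by
  have hlimf := tendsto_zonalForm (hf.memLp_two hh)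
  have hlimA : Tendsto (fun m => ∑ i, zonalForm m (h i)) atTop (𝓝 (∑ i, ∫ x, ‖h i x‖ ^ 2 ∂σ)) :=
    tendsto_finsetSum _ fun i _ => tendsto_zonalForm (hh i)
  generalize ∑ i, ∫ x, ‖h i x‖ ^ 2 ∂σ = A at hlimA ⊢
  generalize ∫ x, ‖f x‖ ^ 2 ∂σ = L at hlimf ⊢
  rw [Metric.tendsto_atTop] at hlimA ⊢
  intro ε hε
  obtain ⟨n, hn⟩ := hlimA (ε / 2) (half_pos hε)
  refine ⟨n, fun m hm => ?_⟩
  -- Beyond n the forms of the derivatives are within ε/2 of A, so the recursion telescopes over m,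
  -- …, m + k with relative error ε/2. Then k tends to infinity, and multiplying by m + 1 removes
  -- the weight.
  have key (k : ℕ) : |zonalForm (m + k) f - zonalForm m f -
      A * (1 / (m + 1) - 1 / ((m + k : ℕ) + 1))| ≤
        ε / 2 * (1 / (m + 1) - 1 / ((m + k : ℕ) + 1)) := by
    induction k with
    | zero => simp
    | succ k ih =>
      have h1 := hf.zonalForm_succ (m + k)
      have h2 := hn (m + k + 1) (by omega)
      rw [Real.dist_eq] at h2
      have h3 : (0 : ℝ) ≤ 1 / ((m + k : ℕ) + 1) - 1 / ((m + k : ℕ) + 2) :=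
        sub_nonneg.2 (one_div_le_one_div_of_le (by positivity) (by linarith))
      have h4 := mul_le_mul_of_nonneg_right h2.le h3
      rw [← abs_of_nonneg h3, ← abs_mul, abs_of_nonneg h3, sub_mul, ← h1] at h4
      rw [← add_assoc, Nat.cast_add_one (m + k),
        show ((m + k : ℕ) : ℝ) + 1 + 1 = (m + k : ℕ) + 2 by ring]
      rw [abs_le] at ih h4 ⊢
      constructor <;> linarith [ih.1, ih.2, h4.1, h4.2]
  have hk : Tendsto (fun k : ℕ => 1 / (((m + k : ℕ) : ℝ) + 1)) atTop (𝓝 0) :=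
    tendsto_one_div_add_atTop_nhds_zero_nat.comp (tendsto_add_atTop_nat m |>.congr fun k => add_comm k m)
  have hb : |L - zonalForm m f - A * (1 / (m + 1) - 0)| ≤ ε / 2 * (1 / (m + 1) - 0) := by
    have hf' : Tendsto (fun k => zonalForm (m + k) f) atTop (𝓝 L) :=
      hlimf.comp (tendsto_add_atTop_nat m |>.congr fun k => add_comm k m)
    exact le_of_tendsto_of_tendsto'
      ((hf'.sub_const (zonalForm m f)).sub ((hk.const_sub (1 / (m + 1 : ℝ))).const_mul A)).abs
      ((hk.const_sub (1 / (m + 1 : ℝ))).const_mul (ε / 2)) key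
  have hm0 : (0 : ℝ) < m + 1 := by positivity
  have h5 := mul_le_mul_of_nonneg_left hb hm0.le
  rw [← abs_of_pos hm0, ← abs_mul, abs_of_pos hm0] at h5
  have e1 : (m + 1 : ℝ) * (L - zonalForm m f - A * (1 / (m + 1) - 0)) =
      (m + 1) * (L - zonalForm m f) - A := by
    field_simp
    ring
  have e2 : (m + 1 : ℝ) * (ε / 2 * (1 / (m + 1) - 0)) = ε / 2 := by
    field_simp
    ring
  rw [e1, e2] at h5
  rw [Real.dist_eq]
  linarith

end Averages

/-! ### The spherical ensemble kernel in sphere coordinates -/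

section EnsembleKernel

lemma kernel_self (N : ℕ) (x : S2) : kernel N x x = N := by
  have h : (0 : ℝ) < 1 + ‖stereo x‖ ^ 2 := by positivity
  rw [kernel, Complex.mul_conj', ← mul_pow, Real.mul_self_sqrt h.le]
  push_cast
  have h' : (1 + (‖stereo x‖ : ℂ) ^ 2) ≠ 0 := by exact_mod_cast h.ne'
  field_simp

lemma kernel_conj (N : ℕ) (x y : S2) : kernel N y x = conj (kernel N x y) := by
  simp only [kernel, map_div₀, map_mul, map_pow, map_add, map_one, Complex.conj_conj,
    Complex.conj_ofReal, map_natCast]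
  rw [mul_comm (conj (stereo x)), mul_comm (Real.sqrt (1 + ‖stereo x‖ ^ 2) ^ (N - 1))]

lemma stereo_re (x : S2) : (stereo x).re = (x : E3) 0 / (1 - (x : E3) 2) := by
  rw [stereo, show (1 - ((x : E3) 2 : ℂ)) = ((1 - (x : E3) 2 : ℝ) : ℂ) by push_cast; rfl,
    Complex.div_ofReal_re]
  simp

lemma stereo_im (x : S2) : (stereo x).im = (x : E3) 1 / (1 - (x : E3) 2) := by
  rw [stereo, show (1 - ((x : E3) 2 : ℂ)) = ((1 - (x : E3) 2 : ℝ) : ℂ) by push_cast; rfl,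
    Complex.div_ofReal_im]
  simp

lemma one_add_norm_stereo_sq {x : S2} (hx : (x : E3) 2 ≠ 1) :
    1 + ‖stereo x‖ ^ 2 = 2 / (1 - (x : E3) 2) := by
  have h : 1 - (x : E3) 2 ≠ 0 := sub_ne_zero.2 hx.symm
  rw [Complex.sq_norm, Complex.normSq_apply, stereo_re, stereo_im]
  have := S2.norm_sq x
  field_simp
  linear_combination this

lemma norm_one_add_stereo_sq {x y : S2} (hx : (x : E3) 2 ≠ 1) (hy : (y : E3) 2 ≠ 1) :
    ‖1 + stereo x * conj (stereo y)‖ ^ 2 =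
      2 * (1 + ⟪(x : E3), (y : E3)⟫) / ((1 - (x : E3) 2) * (1 - (y : E3) 2)) := by
  have h : 1 - (x : E3) 2 ≠ 0 := sub_ne_zero.2 hx.symm
  have h' : 1 - (y : E3) 2 ≠ 0 := sub_ne_zero.2 hy.symm
  rw [Complex.sq_norm, Complex.normSq_apply]
  simp only [Complex.add_re, Complex.add_im, Complex.mul_re, Complex.mul_im, Complex.conj_re,
    Complex.conj_im, Complex.one_re, Complex.one_im, stereo_re, stereo_im, inner_eq_three]
  have hx1 := S2.norm_sq x
  have hy1 := S2.norm_sq y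
  field_simp
  linear_combination ((y : E3) 0 ^ 2 + (y : E3) 1 ^ 2) * hx1 + (1 - (x : E3) 2 ^ 2) * hy1

/-- It rests on |1 + z w̄|² / ((1+|z|²)(1+|w|²)) = (1 + ⟨x,y⟩)/2. The north pole is excluded because
`stereo` takes a default value there. -/
lemma norm_kernel_sq (m : ℕ) {x y : S2} (hx : (x : E3) 2 ≠ 1) (hy : (y : E3) 2 ≠ 1) :
    ‖kernel (m + 1) x y‖ ^ 2 = (m + 1) * zonalKernel m x y := by
  have h : 1 - (x : E3) 2 ≠ 0 := sub_ne_zero.2 hx.symm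
  have h' : 1 - (y : E3) 2 ≠ 0 := sub_ne_zero.2 hy.symm
  have e (z : ℂ) : (Real.sqrt (1 + ‖z‖ ^ 2) ^ m) ^ 2 = (1 + ‖z‖ ^ 2) ^ m := by
    rw [← pow_mul, mul_comm, pow_mul, Real.sq_sqrt (by positivity)]
  rw [kernel, norm_div, norm_mul, norm_pow, Complex.norm_natCast, Complex.norm_real,
    Real.norm_of_nonneg (by positivity), div_pow, mul_pow, Nat.add_sub_cancel, mul_pow, e, e,
    ← pow_mul, mul_comm m 2, pow_mul, norm_one_add_stereo_sq hx hy, one_add_norm_stereo_sq hx,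
    one_add_norm_stereo_sq hy, mul_div_assoc, ← mul_pow, ← div_pow, zonalKernel, zonal]
  rw [show 2 * (1 + ⟪(x : E3), (y : E3)⟫) / ((1 - (x : E3) 2) * (1 - (y : E3) 2)) /
    (2 / (1 - (x : E3) 2) * (2 / (1 - (y : E3) 2))) = (1 + ⟪(x : E3), (y : E3)⟫) / 2 by
      field_simp]
  push_cast
  ring

/-- On the diagonal the zonal kernel is m + 1 while its total mass is one, so an atom would have
mass at most 1/m for every m ≥ 1. -/
instance : NullSingletonClass σ := by
  refine ⟨fun p => ?_⟩
  have h (m : ℕ) : (m : ℝ≥0∞) * σ {p} ≤ 1 := by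
    rw [← lintegral_zonalKernel m p]
    refine le_trans ?_ (setLIntegral_le_lintegral {p} _)
    rw [lintegral_singleton]
    gcongr
    have hp : ⟪(p : E3), (p : E3)⟫ = 1 := by rw [real_inner_self_eq_norm_sq]; simp
    rw [zonalKernel, zonal, hp, ← ENNReal.ofReal_natCast]
    apply ENNReal.ofReal_le_ofReal
    norm_num
  by_contra hne
  obtain ⟨n, hn⟩ := ENNReal.exists_nat_mul_gt hne ENNReal.one_ne_top
  exact absurd (h n) (not_le.2 hn)

lemma ae_ne_north : ∀ᵐ x : S2 ∂σ, (x : E3) 2 ≠ 1 := by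
  have hs : {x : S2 | (x : E3) 2 = 1}.Subsingleton := by
    intro x hx y hy
    simp only [mem_ofPred_eq] at hx hy
    have hx1 := S2.norm_sq x
    have hy1 := S2.norm_sq y
    rw [hx] at hx1
    rw [hy] at hy1
    have hx0 : (x : E3) 0 = 0 := by nlinarith [sq_nonneg ((x : E3) 0), sq_nonneg ((x : E3) 1)]
    have hx1 : (x : E3) 1 = 0 := by nlinarith [sq_nonneg ((x : E3) 0), sq_nonneg ((x : E3) 1)]
    have hy0 : (y : E3) 0 = 0 := by nlinarith [sq_nonneg ((y : E3) 0), sq_nonneg ((y : E3) 1)]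
    have hy1 : (y : E3) 1 = 0 := by nlinarith [sq_nonneg ((y : E3) 0), sq_nonneg ((y : E3) 1)]
    ext j
    fin_cases j <;> simp [*]
  rw [ae_iff]
  simpa using hs.measure_zero σ

end EnsembleKernel

/-! ### First and second intensity measures -/

section Intensities

variable {Ω : Type*} [MeasurableSpace Ω] {P : Measure Ω}

/-- The first intensity measure of the spherical ensemble. -/
lemma IsSphericalEnsemble.sum_map {N : ℕ} {x : Fin N → Ω → S2} (hx : IsSphericalEnsemble P N x) :
    ∑ j, P.map (x j) = (N : ℝ≥0∞) • σ := by
  ext s hs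
  have hφ : Measurable fun v : Fin 1 → S2 => s.indicator (1 : S2 → ℝ≥0∞) (v 0) :=
    (measurable_one.indicator hs).comp (measurable_pi_apply 0)
  have h := hx.jointIntensity 1 _ hφ
  have hL : ∫⁻ ω, ∑ e : Fin 1 ↪ Fin N, s.indicator (1 : S2 → ℝ≥0∞) (x (e 0) ω) ∂P =
      (∑ j, P.map (x j)) s := by
    have e1 (ω : Ω) : ∑ e : Fin 1 ↪ Fin N, s.indicator (1 : S2 → ℝ≥0∞) (x (e 0) ω) =
        ∑ j, s.indicator (1 : S2 → ℝ≥0∞) (x j ω) :=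
      Fintype.sum_equiv Equiv.uniqueEmbeddingEquivResult _ _ fun e => rfl
    simp only [e1]
    have hm (j : Fin N) : Measurable fun ω => s.indicator (1 : S2 → ℝ≥0∞) (x j ω) :=
      (measurable_one.indicator hs).comp (hx.measurable j)
    rw [lintegral_finsetSum _ fun j _ => hm j, Measure.finsetSum_apply]
    refine Finset.sum_congr rfl fun j _ => ?_
    rw [← lintegral_map (measurable_one.indicator hs) (hx.measurable j), lintegral_indicator_one hs]
  have hR : ∫⁻ y : Fin 1 → S2, s.indicator (1 : S2 → ℝ≥0∞) (y 0) * ENNReal.ofReal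
      (Matrix.det (Matrix.of fun i j => kernel N (y i) (y j))).re ∂(Measure.pi fun _ => σ) =
      (N : ℝ≥0∞) * σ s := by
    simp only [Matrix.det_unique, Matrix.of_apply, kernel_self, Complex.natCast_re,
      ENNReal.ofReal_natCast]
    rw [lintegral_mul_const _ hφ, mul_comm, ← lintegral_indicator_one hs]
    congr 1
    exact (measurePreserving_eval (fun _ : Fin 1 => σ) 0).lintegral_comp (measurable_one.indicator hs)
  rw [hL, hR] at h
  rw [h]
  rfl

/-- The second intensity measure of the spherical ensemble. -/
lemma IsSphericalEnsemble.sum_map_pair {m : ℕ} {x : Fin (m + 1) → Ω → S2}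
    (hx : IsSphericalEnsemble P (m + 1) x) :
    ∑ e : Fin 2 ↪ Fin (m + 1), P.map (fun ω => (x (e 0) ω, x (e 1) ω)) +
      ((m + 1 : ℕ) : ℝ≥0∞) • zonalMeasure m = ((m + 1 : ℕ) ^ 2 : ℝ≥0∞) • σ.prod σ := by
  have hxm (e : Fin 2 ↪ Fin (m + 1)) : Measurable fun ω => (x (e 0) ω, x (e 1) ω) :=
    (hx.measurable _).prodMk (hx.measurable _)
  ext s hs
  have hi : Measurable (s.indicator (1 : S2 × S2 → ℝ≥0∞)) := measurable_one.indicator hs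
  have hφ : Measurable fun v : Fin 2 → S2 => s.indicator (1 : S2 × S2 → ℝ≥0∞) (v 0, v 1) :=
    hi.comp ((measurable_pi_apply 0).prodMk (measurable_pi_apply 1))
  have h := hx.jointIntensity 2 _ hφ
  have hL : ∫⁻ ω, ∑ e : Fin 2 ↪ Fin (m + 1),
      s.indicator (1 : S2 × S2 → ℝ≥0∞) (x (e 0) ω, x (e 1) ω) ∂P =
      (∑ e : Fin 2 ↪ Fin (m + 1), P.map (fun ω => (x (e 0) ω, x (e 1) ω))) s := by
    have hm (e : Fin 2 ↪ Fin (m + 1)) :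
        Measurable fun ω => s.indicator (1 : S2 × S2 → ℝ≥0∞) (x (e 0) ω, x (e 1) ω) :=
      hi.comp (hxm e)
    rw [lintegral_finsetSum _ fun e _ => hm e, Measure.finsetSum_apply]
    refine Finset.sum_congr rfl fun e _ => ?_
    rw [← lintegral_map hi (hxm e), lintegral_indicator_one hs]
  have hR : ∫⁻ y : Fin 2 → S2, s.indicator (1 : S2 × S2 → ℝ≥0∞) (y 0, y 1) * ENNReal.ofReal
      (Matrix.det (Matrix.of fun i j => kernel (m + 1) (y i) (y j))).re ∂(Measure.pi fun _ => σ) =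
      ∫⁻ p in s, ENNReal.ofReal ((m + 1) ^ 2 - (m + 1) * zonalKernel m p.1 p.2) ∂(σ.prod σ) := by
    have hdet (y : Fin 2 → S2) :
        (Matrix.det (Matrix.of fun i j => kernel (m + 1) (y i) (y j))).re =
          (m + 1) ^ 2 - ‖kernel (m + 1) (y 0) (y 1)‖ ^ 2 := by
      rw [Matrix.det_fin_two]
      simp only [Matrix.of_apply, kernel_self]
      rw [kernel_conj (m + 1) (y 0) (y 1), Complex.mul_conj', Complex.sub_re]
      norm_cast
      rw [sq, sq]
    simp only [hdet]
    rw [← (measurePreserving_piFinTwo fun _ : Fin 2 => σ).symm.lintegral_comp_emb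
      (MeasurableEquiv.measurableEmbedding _), ← lintegral_indicator hs]
    refine lintegral_congr_ae ?_
    filter_upwards [Measure.quasiMeasurePreserving_fst.ae ae_ne_north,
      Measure.quasiMeasurePreserving_snd.ae ae_ne_north] with p h1 h2
    by_cases hp : p ∈ s
    · simp [MeasurableEquiv.piFinTwo, hp, norm_kernel_sq m h1 h2]
    · simp [MeasurableEquiv.piFinTwo, hp]
  rw [hL, hR] at h
  rw [Measure.add_apply, h, Measure.smul_apply, Measure.smul_apply, zonalMeasure,
    withDensity_apply _ hs, smul_eq_mul, smul_eq_mul,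
    ← lintegral_const_mul _ (measurable_zonalDensity m), ← lintegral_add_right _
      ((measurable_zonalDensity m).const_mul _), ← setLIntegral_const]
  refine setLIntegral_congr_fun hs fun p _ => ?_
  -- This keeps the determinant (m+1)² − (m+1)k_m nonnegative, so `ENNReal.ofReal` truncates
  -- nothing.
  have hle : zonalKernel m p.1 p.2 ≤ m + 1 := by
    have h1 := inner_le_one_S2 p.1 p.2
    have h2 := neg_le_of_abs_le (abs_real_inner_le_norm (p.1 : E3) (p.2 : E3))
    simp only [norm_eq_of_mem_sphere, mul_one] at h2
    exact mul_le_of_le_one_right (by positivity) (pow_le_one₀ (by linarith) (by linarith))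
  rw [← ENNReal.ofReal_natCast, ← ENNReal.ofReal_mul (by positivity), ← ENNReal.ofReal_add,
    ← ENNReal.ofReal_pow (by positivity)]
  · congr 1
    push_cast
    ring
  · have : (0 : ℝ) ≤ m + 1 := by positivity
    nlinarith
  · exact mul_nonneg (by positivity) (zonal_nonneg m p.1 p.2)

end Intensities

lemma sum_sum_eq_sum_diag_add_sum_embedding {M : Type*} [AddCommMonoid M] {N : ℕ}
    (Q : Fin N → Fin N → M) :
    ∑ i, ∑ j, Q i j = ∑ i, Q i i + ∑ e : Fin 2 ↪ Fin N, Q (e 0) (e 1) := by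
  have h1 : ∑ e : Fin 2 ↪ Fin N, Q (e 0) (e 1) =
      ∑ p ∈ (Finset.univ : Finset (Fin N)).offDiag, Q p.1 p.2 := by
    refine Finset.sum_bij (fun e _ => (e 0, e 1)) ?_ ?_ ?_ fun _ _ => rfl
    · intro e _
      simp
    · intro e _ e' _ h
      simp only [Prod.mk.injEq] at h
      ext k
      fin_cases k <;> simp [h.1, h.2]
    · rintro ⟨a, b⟩ hab
      have hne : a ≠ b := by simpa using hab
      refine ⟨⟨![a, b], ?_⟩, Finset.mem_univ _, rfl⟩
      intro k l hkl
      fin_cases k <;> fin_cases l <;> simp_all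
  rw [h1, ← Finset.sum_product', ← Finset.diag_union_offDiag,
    Finset.sum_union (Finset.disjoint_diag_offDiag _), Finset.sum_diag]

/-! ### The variance of a linear statistic -/

section Variance

variable {Ω : Type*} [MeasurableSpace Ω] {P : Measure Ω} {E : Type*} [NormedAddCommGroup E]

/-- Domination by a multiple of σ transfers measurability and integrability of f from the sphere to
the law of each point. -/
lemma IsSphericalEnsemble.map_le {N : ℕ} {x : Fin N → Ω → S2} (hx : IsSphericalEnsemble P N x)
    (j : Fin N) : P.map (x j) ≤ (N : ℝ≥0∞) • σ := by
  rw [← hx.sum_map]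
  intro s
  rw [Measure.finsetSum_apply]
  exact Finset.single_le_sum (f := fun j => P.map (x j) s) (fun _ _ => zero_le) (Finset.mem_univ j)

lemma IsSphericalEnsemble.map_pair_le {m : ℕ} {x : Fin (m + 1) → Ω → S2}
    (hx : IsSphericalEnsemble P (m + 1) x) (e : Fin 2 ↪ Fin (m + 1)) :
    P.map (fun ω => (x (e 0) ω, x (e 1) ω)) ≤ ((m + 1 : ℕ) ^ 2 : ℝ≥0∞) • σ.prod σ := by
  rw [← hx.sum_map_pair]
  refine le_trans ?_ (Measure.le_add_right le_rfl)
  intro s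
  rw [Measure.finsetSum_apply]
  exact Finset.single_le_sum (f := fun e : Fin 2 ↪ Fin (m + 1) =>
    P.map (fun ω => (x (e 0) ω, x (e 1) ω)) s) (fun _ _ => zero_le) (Finset.mem_univ e)

lemma IsSphericalEnsemble.memLp_map {N : ℕ} {x : Fin N → Ω → S2} (hx : IsSphericalEnsemble P N x)
    {p : ℝ≥0∞} {f : S2 → E} (hf : MemLp f p σ) (j : Fin N) : MemLp f p (P.map (x j)) :=
  hf.of_measure_le_smul (by simp) (hx.map_le j)

lemma IsSphericalEnsemble.memLp_comp {N : ℕ} {x : Fin N → Ω → S2} (hx : IsSphericalEnsemble P N x)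
    {p : ℝ≥0∞} {f : S2 → E} (hf : MemLp f p σ) (j : Fin N) : MemLp (fun ω => f (x j ω)) p P :=
  (hx.memLp_map hf j).comp_of_map (hx.measurable j).aemeasurable

lemma IsSphericalEnsemble.sum_integral [NormedSpace ℝ E] {N : ℕ} {x : Fin N → Ω → S2}
    (hx : IsSphericalEnsemble P N x) {f : S2 → E} (hf : Integrable f σ) :
    ∑ j, ∫ ω, f (x j ω) ∂P = (N : ℝ) • ∫ y, f y ∂σ := by
  have hi (j : Fin N) : Integrable f (P.map (x j)) :=
    memLp_one_iff_integrable.1 (hx.memLp_map (memLp_one_iff_integrable.2 hf) j)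
  have h : ∫ y, f y ∂(∑ j, P.map (x j)) = ∫ y, f y ∂((N : ℝ≥0∞) • σ) := by rw [hx.sum_map]
  rw [integral_finsetSum_measure fun j _ => hi j, integral_smul_measure,
    ENNReal.toReal_natCast] at h
  rw [← h]
  exact Finset.sum_congr rfl fun j _ => (integral_map (hx.measurable j).aemeasurable (hi j).1).symm

variable [InnerProductSpace ℝ E]

lemma IsSphericalEnsemble.integrable_inner_pair {m : ℕ} {x : Fin (m + 1) → Ω → S2}
    (hx : IsSphericalEnsemble P (m + 1) x) {f : S2 → E} (hf : Integrable f σ)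
    (e : Fin 2 ↪ Fin (m + 1)) :
    Integrable (fun p : S2 × S2 => ⟪f p.1, f p.2⟫) (P.map fun ω => (x (e 0) ω, x (e 1) ω)) :=
  (integrable_inner_prod hf hf).of_measure_le_smul (by simp) (hx.map_pair_le e)

lemma integrable_inner_of_memLp_two {α : Type*} [MeasurableSpace α] {ν : Measure α} {f g : α → E}
    (hf : MemLp f 2 ν) (hg : MemLp g 2 ν) : Integrable (fun a => ⟪f a, g a⟫) ν :=
  (hf.norm.integrable_mul hg.norm).mono' (hf.1.inner hg.1)
    (Eventually.of_forall fun _ => norm_inner_le_norm _ _)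

lemma integrable_inner_zonalMeasure (m : ℕ) {f : S2 → E} (hf : MemLp f 2 σ) :
    Integrable (fun p : S2 × S2 => ⟪f p.1, f p.2⟫) (zonalMeasure m) :=
  integrable_inner_of_memLp_two (memLp_comp_fst_zonalMeasure m hf) (memLp_comp_snd_zonalMeasure m hf)

lemma IsSphericalEnsemble.sum_integral_inner [CompleteSpace E] {m : ℕ} {x : Fin (m + 1) → Ω → S2}
    (hx : IsSphericalEnsemble P (m + 1) x) {f : S2 → E} (hf : MemLp f 2 σ) :
    ∑ e : Fin 2 ↪ Fin (m + 1), ∫ ω, ⟪f (x (e 0) ω), f (x (e 1) ω)⟫ ∂P =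
      (m + 1) ^ 2 * ‖∫ y, f y ∂σ‖ ^ 2 - (m + 1) * zonalForm m f := by
  have hf1 : Integrable f σ := hf.integrable (by norm_num)
  have hi := hx.integrable_inner_pair hf1
  have h : ∫ p, ⟪f p.1, f p.2⟫ ∂(∑ e : Fin 2 ↪ Fin (m + 1),
      P.map (fun ω => (x (e 0) ω, x (e 1) ω)) + ((m + 1 : ℕ) : ℝ≥0∞) • zonalMeasure m) =
      ∫ p, ⟪f p.1, f p.2⟫ ∂(((m + 1 : ℕ) ^ 2 : ℝ≥0∞) • σ.prod σ) := by rw [hx.sum_map_pair]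
  have h0 : ∫ p : S2 × S2, ⟪f p.1, f p.2⟫ ∂(σ.prod σ) = ‖∫ y, f y ∂σ‖ ^ 2 := by
    rw [← zonalForm_zero hf1, zonalForm, kernelForm]
    simp [zonalKernel, zonal]
  rw [integral_add_measure (integrable_finsetSum_measure.2 fun e _ => hi e)
    ((integrable_inner_zonalMeasure m hf).smul_measure (by simp)),
    integral_finsetSum_measure fun e _ => hi e, integral_smul_measure, integral_smul_measure,
    ← zonalForm_eq_integral, h0, ENNReal.toReal_pow, ENNReal.toReal_natCast, smul_eq_mul,
    smul_eq_mul] at h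
  have e1 (e : Fin 2 ↪ Fin (m + 1)) : ∫ ω, ⟪f (x (e 0) ω), f (x (e 1) ω)⟫ ∂P =
      ∫ p, ⟪f p.1, f p.2⟫ ∂(P.map fun ω => (x (e 0) ω, x (e 1) ω)) :=
    (integral_map ((hx.measurable _).prodMk (hx.measurable _)).aemeasurable (hi e).1).symm
  rw [Finset.sum_congr rfl fun e _ => e1 e]
  push_cast at h
  linarith

lemma integral_norm_sub_integral_sq [CompleteSpace E] [IsProbabilityMeasure P] {S : Ω → E}
    (hS : MemLp S 2 P) :
    ∫ ω, ‖S ω - ∫ ω', S ω' ∂P‖ ^ 2 ∂P = ∫ ω, ‖S ω‖ ^ 2 ∂P - ‖∫ ω, S ω ∂P‖ ^ 2 := by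
  set c := ∫ ω, S ω ∂P
  have hS1 : Integrable S P := hS.integrable (by norm_num)
  have i1 := (memLp_two_iff_integrable_sq_norm hS.1).1 hS
  have i2 : Integrable (fun ω => 2 * ⟪c, S ω⟫) P := (hS1.const_inner c).const_mul 2
  have e (ω : Ω) : ‖S ω - c‖ ^ 2 = ‖S ω‖ ^ 2 - 2 * ⟪c, S ω⟫ + ‖c‖ ^ 2 := by
    rw [norm_sub_sq_real, real_inner_comm]
  have h2 : ∫ ω, ⟪c, S ω⟫ ∂P = ‖c‖ ^ 2 := by
    rw [integral_inner hS1, real_inner_self_eq_norm_sq]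
  simp only [e]
  rw [integral_add (f := fun ω => ‖S ω‖ ^ 2 - 2 * ⟪c, S ω⟫) (i1.sub i2) (integrable_const _),
    integral_sub i1 i2, integral_const_mul, h2]
  simp
  ring

/-- The variance of a linear statistic of the spherical ensemble. -/
lemma IsSphericalEnsemble.variance_sum [CompleteSpace E] [IsProbabilityMeasure P] {m : ℕ}
    {x : Fin (m + 1) → Ω → S2} (hx : IsSphericalEnsemble P (m + 1) x) {f : S2 → E}
    (hf : MemLp f 2 σ) :
    ∫ ω, ‖∑ j, f (x j ω) - ∫ ω', ∑ j, f (x j ω') ∂P‖ ^ 2 ∂P =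
      (m + 1) * (∫ y, ‖f y‖ ^ 2 ∂σ - zonalForm m f) := by
  have hf1 : Integrable f σ := hf.integrable (by norm_num)
  have hj (j : Fin (m + 1)) : MemLp (fun ω => f (x j ω)) 2 P := hx.memLp_comp hf j
  have hS : MemLp (fun ω => ∑ j, f (x j ω)) 2 P := memLp_finsetSum _ fun j _ => hj j
  rw [integral_norm_sub_integral_sq hS,
    integral_finsetSum _ fun j _ => (hj j).integrable (by norm_num), hx.sum_integral hf1]
  have hin (i j : Fin (m + 1)) : Integrable (fun ω => ⟪f (x i ω), f (x j ω)⟫) P :=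
    integrable_inner_of_memLp_two (hj i) (hj j)
  have e (ω : Ω) : ‖∑ j, f (x j ω)‖ ^ 2 = ∑ i, ∑ j, ⟪f (x i ω), f (x j ω)⟫ := by
    rw [← real_inner_self_eq_norm_sq, sum_inner]
    simp only [inner_sum]
  simp only [e]
  rw [integral_finsetSum _ fun i _ => integrable_finsetSum _ fun j _ => hin i j]
  simp only [integral_finsetSum _ fun j _ => hin _ j]
  -- The diagonal yields N‖f‖². Pairs of distinct labels yield N²‖∫ f‖² − N Q_m(f), whose first term
  -- cancels the squared mean.
  rw [sum_sum_eq_sum_diag_add_sum_embedding fun i j => ∫ ω, ⟪f (x i ω), f (x j ω)⟫ ∂P,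
    hx.sum_integral_inner hf]
  simp only [real_inner_self_eq_norm_sq]
  rw [hx.sum_integral (f := fun y => ‖f y‖ ^ 2) ((memLp_two_iff_integrable_sq_norm hf.1).1 hf),
    norm_smul, mul_pow, smul_eq_mul]
  simp only [Real.norm_natCast]
  push_cast
  ring

end Variance

end SphericalEnsemble

end

theorem mainTheorem8 {𝕜 : Type*} [RCLike 𝕜] {Ω : ℕ → Type*} [∀ N, MeasurableSpace (Ω N)]
    (P : ∀ N, MeasureTheory.Measure (Ω N)) [∀ N, MeasureTheory.IsProbabilityMeasure (P N)]
    (x : ∀ N, Fin N → Ω N → SphericalEnsemble.S2)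
    (hx : ∀ N, SphericalEnsemble.IsSphericalEnsemble (P N) N (x N))
    (f : SphericalEnsemble.S2 → 𝕜) (G : SphericalEnsemble.S2 → EuclideanSpace 𝕜 (Fin 3))
    (hG : SphericalEnsemble.IsWeakGradient f G)
    (hG2 : MeasureTheory.MemLp G 2 SphericalEnsemble.σ) :
    (∀ N, MeasureTheory.MemLp (fun ω => ∑ j, f (x N j ω)) 2 (P N)) ∧
    Filter.Tendsto
      (fun N => SphericalEnsemble.scalarVariance (P N) (fun ω => ∑ j, f (x N j ω)))
      Filter.atTop (nhds (∫ y, ‖G y‖ ^ 2 ∂SphericalEnsemble.σ)) := by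
  have hd := hG.hasRotDeriv
  have hh (i : Fin 3) : MeasureTheory.MemLp (SphericalEnsemble.rotComponent G i) 2 SphericalEnsemble.σ := SphericalEnsemble.memLp_rotComponent hG2 i
  have hf := hd.memLp_two hh
  refine ⟨fun N => MeasureTheory.memLp_finsetSum _ fun j _ => (hx N).memLp_comp hf j, ?_⟩
  -- The variance formula is stated for N = m + 1 points; the empty ensemble does not affect the
  -- limit.
  rw [← Filter.tendsto_add_atTop_iff_nat 1]
  have hsum : ∑ i, ∫ y, ‖SphericalEnsemble.rotComponent G i y‖ ^ 2 ∂SphericalEnsemble.σ = ∫ y, ‖G y‖ ^ 2 ∂SphericalEnsemble.σ := by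
    rw [← MeasureTheory.integral_finsetSum _ fun i _ =>
      (MeasureTheory.memLp_two_iff_integrable_sq_norm (hh i).1).1 (hh i)]
    refine MeasureTheory.integral_congr_ae ?_
    filter_upwards [hG.tangent] with y hy using SphericalEnsemble.sum_norm_rotComponent_sq hy
  rw [← hsum]
  refine (hd.tendsto_defect hh).congr fun m => ?_
  exact ((hx (m + 1)).variance_sum hf).symm
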